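/- Let $\mathfrak g=\mathfrak{so}_7(\mathbb C)$ be the Lie algebra $B_3$, realized as the complex $7\times7$ matrices $A$ with $a_{ij}=-a_{j'i'}$, $i'=8-i$, with the Cartan subalgebra $\mathfrak h$ of its diagonal matrices and the simple roots $\alpha_1=\varepsilon_1-\varepsilon_2$, $\alpha_2=\varepsilon_2-\varepsilon_3$, $\alpha_3=\varepsilon_3$, where $\varepsilon_i(\mathrm{diag}(b_1,b_2,b_3,0,-b_3,-b_2,-b_1))=b_i$. For $k\ge1$ let $\Delta_2^+(k)$ be the set of positive roots in which $\alpha_2$ has coefficient $k$, put $\mathfrak m^+_k=\bigoplus_{\alpha\in\Delta_2^+(k)}\mathfrak g_\alpha$ and $\mathfrak m^+=\bigoplus_{k\ge1}\mathfrak m_k^+$, and let $\mathfrak p$ be the parabolic subalgebra spanned by $\mathfrak h$ and the root spaces of all roots outside $\bigcup_{k\ge1}\Delta^+_2(k)$. Let $G=SO_7(\mathbb C)$ be the group of complex $7\times 7$ matrices of determinant one preserving the symmetric bilinear form $\sum_i x_iy_{i'}$, let $P\subset G$ be the parabolic subgroup with Lie algebra $\mathfrak p$ (the normalizer of $\mathfrak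 p$ in $G$), and let $M=(B_3,\alpha_2)=G/P$, a complex manifold whose holomorphic tangent space at the base point $eP$ is $\mathfrak g/\mathfrak p\cong\mathfrak m^+$. Let $K(A,B)=\tfrac12\operatorname{tr}(AB)$ (the Killing form of $\mathfrak g$, rescaled), let $\bar A=-A^*$ be the conjugation of $\mathfrak g$ with respect to its compact real form, and let $G_u=G\cap U(7)$. Then $M$ has complex dimension $7$. There is exactly one smooth Hermitian metric $g_0$ on $M$ which is invariant under $G_u$ and which at the base point satisfies $g_0(X,\bar Y)=-k\,K(X,\bar Y)$ for $X,Y\in\mathfrak m^+_k$ $(k\ge 1)$, with $\mathfrak m^+_k\perp\mathfrak m^+_l$ for $k\ne l$ (the canonical metric). This metric is Kähler–Einstein, and its Ricci curvature is identically equal to $4$: in all local holomorphic coordinates, $\mathrm{Ric}_{i\bar j}=4\,(g_0)_{i\bar j}$ everywhere on $M$. -/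

import Mathlib

open scoped ContDiff ComplexConjugate

noncomputable section

namespace BThree

attribute [local instance] LieRing.ofAssociativeRing

/-- Complex `7 × 7` matrices; the index `i' = 8 - i` of a 1-based index is `Fin.rev i` here. -/
abbrev Mat := Matrix (Fin 7) (Fin 7) ℂ

/-! ### The Lie algebra, its roots, and the grading defined by the second simple root -/

/-- The Lie algebra `B₃ = so₇(ℂ)`: the matrices with `a i j = - a j' i'`. -/
def so7 : LieSubalgebra ℂ Mat where
  carrier := {A | ∀ i j, A i j = - A j.rev i.rev}
  zero_mem' := by intro i j; simp
  add_mem' := by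
    intro A B hA hB i j
    simp only [Matrix.add_apply, hA i j, hB i j]
    ring
  smul_mem' := by
    intro c A hA i j
    simp only [Matrix.smul_apply, hA i j, smul_eq_mul]
    ring
  lie_mem' := by
    intro A B hA hB i j
    simp only [Ring.lie_def, Matrix.sub_apply, Matrix.mul_apply]
    have h1 : ∑ k, A i k * B k j = ∑ k, B j.rev k * A k i.rev := by
      rw [← Equiv.sum_comp Fin.revPerm]
      refine Finset.sum_congr rfl fun k _ => ?_
      simp only [Fin.revPerm_apply]
      rw [hA i k.rev, hB k.rev j, Fin.rev_rev]
      ring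
    have h2 : ∑ k, B i k * A k j = ∑ k, A j.rev k * B k i.rev := by
      rw [← Equiv.sum_comp Fin.revPerm]
      refine Finset.sum_congr rfl fun k _ => ?_
      simp only [Fin.revPerm_apply]
      rw [hB i k.rev, hA k.rev j, Fin.rev_rev]
      ring
    rw [h1, h2]
    ring

/-- The Cartan subalgebra of diagonal matrices in `so₇(ℂ)`. -/
def cartan : Submodule ℂ Mat where
  carrier := {A | A ∈ so7 ∧ ∀ i j, i ≠ j → A i j = 0}
  zero_mem' := ⟨so7.zero_mem, by simp⟩
  add_mem' := by
    rintro A B ⟨hA, hA2⟩ ⟨hB, hB2⟩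
    exact ⟨so7.add_mem hA hB, fun i j hij => by simp [hA2 i j hij, hB2 i j hij]⟩
  smul_mem' := by
    rintro c A ⟨hA, hA2⟩
    exact ⟨so7.smul_mem c hA, fun i j hij => by simp [hA2 i j hij]⟩

/-- The functional `εᵢ` on the Cartan subalgebra, `ε i (diag (b₁, b₂, b₃, 0, -b₃, -b₂, -b₁)) = bᵢ`. -/
def eps (i : Fin 3) (H : Mat) : ℂ := H (Fin.castLE (by norm_num) i) (Fin.castLE (by norm_num) i)

/-- The simple roots `α₁ = ε₁ - ε₂`, `α₂ = ε₂ - ε₃`, `α₃ = ε₃`. -/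
def simpleRoot (i : Fin 3) (H : Mat) : ℂ :=
  ![eps 0 H - eps 1 H, eps 1 H - eps 2 H, eps 2 H] i

/-- The root space of the functional `n₁ α₁ + n₂ α₂ + n₃ α₃` (zero if this is not a weight). -/
def rootSpace (n : Fin 3 → ℤ) : Submodule ℂ Mat where
  carrier := {X | X ∈ so7 ∧ ∀ H ∈ cartan, ⁅H, X⁆ = (∑ i, (n i : ℂ) * simpleRoot i H) • X}
  zero_mem' := ⟨so7.zero_mem, by simp⟩
  add_mem' := by
    rintro A B ⟨hA, hA2⟩ ⟨hB, hB2⟩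
    exact ⟨so7.add_mem hA hB, fun H hH => by rw [lie_add, hA2 H hH, hB2 H hH, smul_add]⟩
  smul_mem' := by
    rintro c A ⟨hA, hA2⟩
    exact ⟨so7.smul_mem c hA, fun H hH => by rw [lie_smul, hA2 H hH, smul_comm]⟩

/-- `n₁ α₁ + n₂ α₂ + n₃ α₃` is a root. -/
def IsRoot (n : Fin 3 → ℤ) : Prop := n ≠ 0 ∧ rootSpace n ≠ ⊥

/-- The set `Δ⁺₂(k)` of positive roots in which `α₂` has coefficient `k`. -/
def posRoots (k : ℤ) : Set (Fin 3 → ℤ) := {n | IsRoot n ∧ (∀ i, 0 ≤ n i) ∧ n 1 = k}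

/-- The graded piece `𝔪⁺ₖ`, the sum of the root spaces of the roots in `Δ⁺₂(k)` (used for `k ≥ 1`). -/
def mPlus (k : ℤ) : Submodule ℂ Mat := ⨆ n ∈ posRoots k, rootSpace n

/-- The parabolic subalgebra: the Cartan subalgebra plus the root spaces of all roots that do not
lie in `Δ⁺₂ = ⋃_{k > 0} Δ⁺₂(k)`. -/
def parabolic : Submodule ℂ Mat :=
  cartan ⊔ ⨆ n ∈ {n | IsRoot n ∧ ∀ k > 0, n ∉ posRoots k}, rootSpace n

/-- The invariant form `K(A, B) = tr(AB)/2`, i.e. the Killing form of `so₇(ℂ)` rescaled so that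
`killing_F` below holds. -/
def killing (A B : Mat) : ℂ := (A * B).trace / 2

/-- The matrices `F i j = e i j - e j' i'`. -/
def F (i j : Fin 7) : Mat := Matrix.single i j 1 - Matrix.single j.rev i.rev 1

theorem F_mem (i j : Fin 7) : F i j ∈ so7 := by
  intro a b
  simp only [F, Matrix.sub_apply, Matrix.single_apply]
  have e2 : (i = b.rev ∧ j = a.rev) ↔ (j.rev = a ∧ i.rev = b) := by
    rw [and_comm, Fin.rev_eq_iff, Fin.rev_eq_iff]
  have e3 : (j.rev = b.rev ∧ i.rev = a.rev) ↔ (i = a ∧ j = b) := by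
    rw [Fin.rev_inj, Fin.rev_inj, and_comm]
  simp only [e2, e3]
  ring

/-- The normalization of the Killing form. -/
theorem killing_F (i j k l : Fin 7) :
    killing (F i j) (F k l) =
      (if i = l ∧ j = k then 1 else 0) - (if j = l.rev ∧ i = k.rev then 1 else 0) := by
  have hs : ∀ a b c d : Fin 7, (Matrix.single a b (1 : ℂ) * Matrix.single c d 1).trace =
      if a = d ∧ b = c then 1 else 0 := by
    intro a b c d
    by_cases hbc : b = c
    · subst hbc
      by_cases had : a = d
      · subst had
        simp
      · simp [had, Matrix.trace_single_eq_of_ne a d (1 : ℂ) had]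
    · simp [hbc]
  simp only [killing, F, sub_mul, mul_sub, Matrix.trace_sub, hs]
  have e1 : (j.rev = k.rev ∧ i.rev = l.rev) ↔ (i = l ∧ j = k) := by
    rw [Fin.rev_inj, Fin.rev_inj, and_comm]
  have e2 : (i = k.rev ∧ j = l.rev) ↔ (j = l.rev ∧ i = k.rev) := and_comm
  have e3 : (j.rev = l ∧ i.rev = k) ↔ (j = l.rev ∧ i = k.rev) := by
    rw [Fin.rev_eq_iff, Fin.rev_eq_iff]
  simp only [e1, e2, e3]
  ring

/-- The complex conjugation of `so₇(ℂ)` with `F i j ↦ - F j i`; its fixed points are the compact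
real form. -/
def cconj (A : Mat) : Mat := - A.conjTranspose

/-! ### The homogeneous space `(B₃, α₂)` -/

/-- The group `SO₇(ℂ)` of the quadratic form with antidiagonal Gram matrix: the matrices `g`
of determinant one with `∑ k, g k i * g k' j = δ i j'`. -/
def SO7 : Subgroup (GL (Fin 7) ℂ) where
  carrier := {g | g.1.transpose * (Fin.revPerm.permMatrix ℂ : Mat) * g.1 =
    (Fin.revPerm.permMatrix ℂ : Mat) ∧ g.1.det = 1}
  one_mem' := by simp
  mul_mem' := by
    rintro a b ⟨ha, ha2⟩ ⟨hb, hb2⟩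
    refine ⟨?_, ?_⟩
    · simp only [Units.val_mul, Matrix.transpose_mul]
      calc _ = b.1.transpose * (a.1.transpose * (Fin.revPerm.permMatrix ℂ : Mat) * a.1) * b.1 := by
            simp only [mul_assoc]
        _ = _ := by rw [ha, hb]
    · simp only [Units.val_mul, Matrix.det_mul, ha2, hb2, mul_one]
  inv_mem' := by
    rintro a ⟨ha, ha2⟩
    have hinv : a.1 * (a⁻¹).1 = 1 := by rw [← Units.val_mul, mul_inv_cancel, Units.val_one]
    refine ⟨?_, ?_⟩
    · have ht : (a⁻¹).1.transpose * a.1.transpose = 1 := by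
        rw [← Matrix.transpose_mul, hinv, Matrix.transpose_one]
      calc _ = (a⁻¹).1.transpose *
              (a.1.transpose * (Fin.revPerm.permMatrix ℂ : Mat) * a.1) * (a⁻¹).1 := by rw [ha]
        _ = ((a⁻¹).1.transpose * a.1.transpose) * (Fin.revPerm.permMatrix ℂ : Mat) *
              (a.1 * (a⁻¹).1) := by simp only [mul_assoc]
        _ = _ := by rw [ht, hinv, one_mul, mul_one]
    · have := congrArg Matrix.det hinv
      rwa [Matrix.det_mul, ha2, one_mul, Matrix.det_one] at this

/-- The underlying matrix of a group element. -/
def toMat (g : SO7) : Mat := g.1.1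

/-- The adjoint action. -/
def Ad (g : SO7) (X : Mat) : Mat := toMat g * X * toMat g⁻¹

theorem Ad_mul (g q : SO7) (X : Mat) : Ad (g * q) X = Ad g (Ad q X) := by
  simp [Ad, toMat, mul_assoc]

theorem Ad_one (X : Mat) : Ad 1 X = X := by
  simp [Ad, toMat]

/-- The parabolic subgroup with Lie algebra `parabolic`: the normalizer of that subalgebra. -/
def P : Subgroup SO7 where
  carrier := {g | ∀ X, Ad g X ∈ parabolic ↔ X ∈ parabolic}
  one_mem' := by intro X; rw [Ad_one]
  mul_mem' := by
    intro a b ha hb X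
    rw [Ad_mul, ha, hb]
  inv_mem' := by
    intro a ha X
    rw [← ha, ← Ad_mul, mul_inv_cancel, Ad_one]

/-- The Kähler C-space `(B₃, α₂) = G / P`. -/
abbrev M := SO7 ⧸ P

/-- The compact real form of `SO₇(ℂ)`, with Lie algebra the fixed points of `cconj`. -/
def compactForm : Subgroup SO7 where
  carrier := {g | toMat g ∈ Matrix.unitaryGroup (Fin 7) ℂ}
  one_mem' := one_mem (Matrix.unitaryGroup (Fin 7) ℂ)
  mul_mem' := by
    intro a b ha hb
    exact (Matrix.unitaryGroup (Fin 7) ℂ).mul_mem ha hb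
  inv_mem' := by
    intro a ha
    have h : toMat a⁻¹ = star (toMat a) := by
      have h1 : star (toMat a) * toMat a = 1 := (Matrix.mem_unitaryGroup_iff').mp ha
      have h2 : toMat a * toMat a⁻¹ = 1 := by simp [toMat]
      calc toMat a⁻¹ = (star (toMat a) * toMat a) * toMat a⁻¹ := by rw [h1, one_mul]
        _ = star (toMat a) := by rw [mul_assoc, h2, mul_one]
    change toMat a⁻¹ ∈ Matrix.unitaryGroup (Fin 7) ℂ
    rw [h]
    exact Unitary.star_mem ha

/-! ### Local holomorphic coordinates -/

/-- For `s : ℂ⁷ → G`, the element `s(x)⁻¹ ∂ᵢ s(x)` of the Lie algebra. Its class modulo the parabolic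
subalgebra represents, in `T_{gP} (G/P) = 𝔤/𝔭` (`X` standing for the velocity of `t ↦ g exp(tX) P`,
with `g = s(x)`), the coordinate vector `∂ᵢ` of the local parametrization `x ↦ s(x) P` of `G/P`. -/
def coordVec (s : (Fin 7 → ℂ) → SO7) (x : Fin 7 → ℂ) (i : Fin 7) : Mat :=
  toMat (s x)⁻¹ *
    Matrix.of fun a b => fderiv ℂ (fun y => toMat (s y) a b) x (Pi.single i 1)

/-- `x ↦ s(x) P`, for `x` in the open set `Ω ⊆ ℂ⁷`, is a system of local holomorphic coordinates
of `G/P` (a local biholomorphism into `G/P`, given by a holomorphic lift `s` to `G`; locally every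
holomorphic coordinate system of `G/P` is of this form). -/
structure IsCoordinates (Ω : Set (Fin 7 → ℂ)) (s : (Fin 7 → ℂ) → SO7) : Prop where
  isOpen : IsOpen Ω
  holomorphic : ∀ a b, AnalyticOnNhd ℂ (fun y => toMat (s y) a b) Ω
  immersion : ∀ x ∈ Ω, ∀ c : Fin 7 → ℂ, (∑ i, c i • coordVec s x i) ∈ parabolic → c = 0

/-! ### Hermitian metrics on `G/P` -/

/-- A family of functions on pairs of tangent vectors: `h g X Y` is the value on the vectors of
`T_{gP} (G/P)` represented by `X` and `Y`. Only `X, Y ∈ so₇(ℂ)` matter. -/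
abbrev Form := SO7 → Mat → Mat → ℂ

/-- The coefficients `h_{i j̄} = h(∂ᵢ, ∂ⱼ)` in the coordinates `x ↦ s(x) P`. -/
def coeff (h : Form) (s : (Fin 7 → ℂ) → SO7) (x : Fin 7 → ℂ) : Mat :=
  Matrix.of fun i j => h (s x) (coordVec s x i) (coordVec s x j)

/-- `h` is a smooth Hermitian metric on the complex manifold `G/P`. -/
structure IsHermitianMetric (h : Form) : Prop where
  add_left : ∀ g, ∀ X ∈ so7, ∀ X₂ ∈ so7, ∀ Y ∈ so7, h g (X + X₂) Y = h g X Y + h g X₂ Y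
  smul_left : ∀ g, ∀ c : ℂ, ∀ X ∈ so7, ∀ Y ∈ so7, h g (c • X) Y = c * h g X Y
  conj_symm : ∀ g, ∀ X ∈ so7, ∀ Y ∈ so7, h g Y X = conj (h g X Y)
  /-- `h g` descends to the tangent space `𝔤/𝔭`. -/
  parabolic_left : ∀ g, ∀ X ∈ parabolic, ∀ Y ∈ so7, h g X Y = 0
  pos : ∀ g, ∀ X ∈ so7, X ∉ parabolic → 0 < (h g X X).re
  /-- `h` descends from `G` to `G/P`: the vector represented by `X` at `gq` is represented by
  `Ad q X` at `g`. -/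
  equivariant : ∀ g, ∀ q ∈ P, ∀ X ∈ so7, ∀ Y ∈ so7, h (g * q) X Y = h g (Ad q X) (Ad q Y)
  smooth : ∀ Ω s, IsCoordinates Ω s → ∀ i j, ContDiffOn ℝ ∞ (fun x => coeff h s x i j) Ω

/-- `h` is the canonical metric: the Hermitian metric on `G/P`, homogeneous under the compact real
form, that is given on the tangent space `𝔪⁺ = ⨁ 𝔪⁺ₖ` at the base point by `-k K(X, Ȳ)` on `𝔪⁺ₖ`,
distinct `𝔪⁺ₖ` being orthogonal. -/
structure IsCanonicalMetric (h : Form) : Prop extends IsHermitianMetric h where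
  homogeneous : ∀ u ∈ compactForm, ∀ g, ∀ X ∈ so7, ∀ Y ∈ so7, h (u * g) X Y = h g X Y
  base : ∀ k > 0, ∀ X ∈ mPlus k, ∀ Y ∈ mPlus k, h 1 X Y = - (k : ℂ) * killing X (cconj Y)
  base_ne : ∀ k > 0, ∀ l > 0, k ≠ l → ∀ X ∈ mPlus k, ∀ Y ∈ mPlus l, h 1 X Y = 0

/-! ### Kähler metrics and Ricci curvature -/

/-- The fundamental 2-form `ω(v, w) = g(Jv, w)`, `g = Re h`, in coordinates. -/
def kahlerForm (h : Form) (s : (Fin 7 → ℂ) → SO7) (x v w : Fin 7 → ℂ) : ℝ :=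
  (∑ i, ∑ j, coeff h s x i j * (Complex.I * v i) * conj (w j)).re

/-- `h` is a Kähler metric: its fundamental form is closed, `dω(u, v, w) = 0`. -/
def IsKahler (h : Form) : Prop :=
  IsHermitianMetric h ∧ ∀ Ω s, IsCoordinates Ω s → ∀ x ∈ Ω, ∀ u v w : Fin 7 → ℂ,
    fderiv ℝ (fun y => kahlerForm h s y v w) x u + fderiv ℝ (fun y => kahlerForm h s y w u) x v +
      fderiv ℝ (fun y => kahlerForm h s y u v) x w = 0

/-- The Wirtinger derivative `∂f/∂zᵢ`. -/
def dz (i : Fin 7) (f : (Fin 7 → ℂ) → ℂ) (x : Fin 7 → ℂ) : ℂ :=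
  (fderiv ℝ f x (Pi.single i 1) - Complex.I * fderiv ℝ f x (Pi.single i Complex.I)) / 2

/-- The Wirtinger derivative `∂f/∂z̄ᵢ`. -/
def dzbar (i : Fin 7) (f : (Fin 7 → ℂ) → ℂ) (x : Fin 7 → ℂ) : ℂ :=
  (fderiv ℝ f x (Pi.single i 1) + Complex.I * fderiv ℝ f x (Pi.single i Complex.I)) / 2

/-- The curvature components of a Kähler metric in holomorphic coordinates,
`R_{i j̄ k l̄} = - ∂ᵢ ∂̄ⱼ h_{k l̄} + ∑ h^{q̄ p} (∂ᵢ h_{k q̄}) (∂̄ⱼ h_{p l̄})`. -/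
def curv (h : Form) (s : (Fin 7 → ℂ) → SO7) (x : Fin 7 → ℂ) (i j k l : Fin 7) : ℂ :=
  - dz i (dzbar j fun y => coeff h s y k l) x +
    ∑ p, ∑ q, (coeff h s x)⁻¹ q p *
      dz i (fun y => coeff h s y k q) x * dzbar j (fun y => coeff h s y p l) x

/-- The Ricci curvature `Ric_{i j̄} = ∑ h^{l̄ k} R_{i j̄ k l̄}`. -/
def ricci (h : Form) (s : (Fin 7 → ℂ) → SO7) (x : Fin 7 → ℂ) (i j : Fin 7) : ℂ :=
  ∑ k, ∑ l, (coeff h s x)⁻¹ l k * curv h s x i j k l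

/-- `h` is a Kähler–Einstein metric whose Ricci curvature is identically equal to `c`. -/
def IsKahlerEinstein (h : Form) (c : ℝ) : Prop :=
  IsKahler h ∧ ∀ Ω s, IsCoordinates Ω s → ∀ x ∈ Ω, ∀ i j,
    ricci h s x i j = (c : ℂ) * coeff h s x i j

end BThree

end

noncomputable section

namespace BThree

attribute [local instance] LieRing.ofAssociativeRing

open Filter Topology

/-! Elements of `P` preserve the isotropic plane spanned by the last two basis vectors (`P_block`),
so `gP` determines a plane in `ℂ⁷`, framed by the columns of the `7 × 2` matrix `A = frame g 1`. The
canonical metric is the pullback of the Fubini–Study form `∂∂̄ log det (A* A)`. It does not change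
under unitary maps on the left or under a change of frame on the right. At the base point it is `∑
deg a · |Xₐ|²` (`canonicalForm_one`); the coefficient 2 in degree two appears because that root
vector has two entries in the last two columns.

An Iwasawa argument gives `G = G_u P` (`exists_compact_mul_parabolic`). Hence an invariant metric is
determined at the base point, which gives uniqueness, and pointwise identities between invariant
objects need checking only there.

Kähler: the coefficients are `h_{i j̄} = ∂ᵢ pⱼ`, with `p = ∂̄ log det (A* A)` (`dz_primitive`), and
second derivatives commute.

Einstein: `Ric_{i j̄} = -∂ᵢ tr(h⁻¹ ∂̄ⱼ h)` (`ricci_eq`). In coordinates `h = c H c*`, where `c` is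
holomorphic and `H` is the metric on the constant root vectors, so the trace is `tr(H⁻¹ ∂̄H)` plus
an antiholomorphic function, which `∂` kills. The first summand is moved to the base point. There
its value in the direction `Z` is, up to conjugation, the sum of the roots of `𝔪⁺`, namely `4(ε₁ +
ε₂)`, on the diagonal of `Z`, whereas `p` is given by `-(ε₁ + ε₂)`. So it equals `-4p`
(`trace_canonicalDeriv`), and `-∂(-4p) = 4h`.

Coordinates around any `gP` are `g exp(X) P` with `X` in the span of the root vectors of `𝔪⁺`, where
`X³ = 0`. -/

theorem mem_so7 {A : Mat} : A ∈ so7 ↔ ∀ i j, A i j = - A j.rev i.rev := Iff.rfl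

/-! ### Roots and weights -/

/-- The values of the diagonal entries on the three fundamental coweights. -/
def wt (k : Fin 3) (i : Fin 7) : ℤ :=
  ![![1, 0, 0, 0, 0, 0, -1], ![1, 1, 0, 0, 0, -1, -1], ![1, 1, 1, 0, -1, -1, -1]] k i

theorem wt_rev (k : Fin 3) (i : Fin 7) : wt k i.rev = - wt k i := by
  revert k i; decide

/-- The fundamental coweights, as elements of the Cartan subalgebra. -/
def coweight (k : Fin 3) : Mat := Matrix.diagonal fun i => (wt k i : ℂ)

theorem coweight_mem (k : Fin 3) : coweight k ∈ cartan := by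
  refine ⟨fun i j => ?_, fun i j hij => Matrix.diagonal_apply_ne _ hij⟩
  by_cases h : i = j
  · subst h
    simp [coweight, wt_rev]
  · have h' : j.rev ≠ i.rev := fun e => h (Fin.rev_inj.1 e).symm
    simp [coweight, Matrix.diagonal_apply_ne _ h, Matrix.diagonal_apply_ne _ h']

theorem simpleRoot_coweight (i k : Fin 3) :
    simpleRoot i (coweight k) = if i = k then 1 else 0 := by
  fin_cases i <;> fin_cases k <;>
    simp [simpleRoot, eps, coweight, wt, Fin.castLE, Matrix.diagonal]

/-- The weights of the standard representation, expanded in simple roots; the lower half of the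
diagonal is minus the upper half. -/
theorem cartan_apply {H : Mat} (hH : H ∈ cartan) (i : Fin 7) :
    H i i = ∑ k, (wt k i : ℂ) * simpleRoot k H := by
  have h := fun i => hH.1 i i
  -- The middle index is fixed by `Fin.rev`, so this entry equals its own negative.
  have h3 : H 3 3 = 0 := by
    have := h 3
    simp only [show Fin.rev (3 : Fin 7) = 3 from rfl] at this
    linear_combination this / 2
  have h4 := h 4
  have h5 := h 5
  have h6 := h 6
  simp only [show Fin.rev (4 : Fin 7) = 2 from rfl, show Fin.rev (5 : Fin 7) = 1 from rfl,
    show Fin.rev (6 : Fin 7) = 0 from rfl] at h4 h5 h6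
  fin_cases i <;>
    simp [Fin.sum_univ_three, simpleRoot, eps, wt, Fin.castLE, h3, h4, h5, h6] <;> ring

theorem bracket_cartan_apply {H : Mat} (hH : H ∈ cartan) (X : Mat) (i j : Fin 7) :
    ⁅H, X⁆ i j = (H i i - H j j) * X i j := by
  have e : H = Matrix.diagonal fun i => H i i := by
    ext a b
    by_cases hab : a = b
    · subst hab; simp
    · rw [hH.2 a b hab, Matrix.diagonal_apply_ne _ hab]
  rw [Ring.lie_def, Matrix.sub_apply]
  rw [e, Matrix.diagonal_mul, Matrix.mul_diagonal]
  simp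
  ring

/-- The coweights are dual to the simple roots, so bracketing with them reads off the coefficients
of the root from any nonzero entry. -/
theorem rootSpace_weight {n : Fin 3 → ℤ} {X : Mat} (hX : X ∈ rootSpace n) {i j : Fin 7}
    (hij : X i j ≠ 0) (k : Fin 3) : n k = wt k i - wt k j := by
  have h := congrFun (congrFun (hX.2 _ (coweight_mem k)) i) j
  rw [bracket_cartan_apply (coweight_mem k), Matrix.smul_apply, smul_eq_mul] at h
  have h := mul_right_cancel₀ hij h
  simp only [simpleRoot_coweight, mul_ite, mul_one, mul_zero, Finset.sum_ite_eq',
    Finset.mem_univ, if_true] at h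
  simp only [coweight, Matrix.diagonal_apply_eq] at h
  exact_mod_cast h.symm

theorem F_apply (i j a b : Fin 7) :
    F i j a b = (if i = a ∧ j = b then 1 else 0) - (if j.rev = a ∧ i.rev = b then 1 else 0) := by
  simp [F, Matrix.single_apply]

/-- The entries `(i, j)` and `(j', i')` have the same weight because reversal negates `wt`. -/
theorem F_mem_rootSpace (i j : Fin 7) : F i j ∈ rootSpace fun k => wt k i - wt k j := by
  refine ⟨F_mem i j, fun H hH => ?_⟩
  ext a b
  rw [bracket_cartan_apply hH, Matrix.smul_apply, smul_eq_mul]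
  by_cases h1 : i = a ∧ j = b
  · obtain ⟨rfl, rfl⟩ := h1
    rw [cartan_apply hH, cartan_apply hH, ← Finset.sum_sub_distrib]
    congr 1
    refine Finset.sum_congr rfl fun k _ => ?_
    push_cast
    ring
  · by_cases h2 : j.rev = a ∧ i.rev = b
    · obtain ⟨rfl, rfl⟩ := h2
      rw [cartan_apply hH, cartan_apply hH, ← Finset.sum_sub_distrib]
      congr 1
      refine Finset.sum_congr rfl fun k _ => ?_
      rw [wt_rev, wt_rev]
      push_cast
      ring
    · rw [F_apply, if_neg h1, if_neg h2]
      simp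

theorem F_ne_zero {i j : Fin 7} (h : j.rev ≠ i) : F i j ≠ 0 := by
  intro e
  have := congrFun (congrFun e i) j
  rw [F_apply, if_pos ⟨rfl, rfl⟩, if_neg (fun h' => h h'.1)] at this
  simp at this

theorem F_rev_self (i : Fin 7) : F i i.rev = 0 := by
  simp [F]

/-- Summing over all positions meets each entry twice, once through its mirror image; hence the
factor one half. -/
theorem so7_eq_sum {X : Mat} (hX : X ∈ so7) : X = ∑ i, ∑ j, (X i j / 2) • F i j := by
  have key : ∑ i, ∑ j, (X i j / 2) • F i j =
      ∑ i, ∑ j, (X i j / 2) • Matrix.single i j (1 : ℂ) -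
        ∑ i, ∑ j, (X i j / 2) • Matrix.single j.rev i.rev (1 : ℂ) := by
    simp only [F, smul_sub, Finset.sum_sub_distrib]
  have h2 : ∑ i, ∑ j, (X i j / 2) • Matrix.single j.rev i.rev (1 : ℂ) =
      - ∑ i, ∑ j, (X i j / 2) • Matrix.single i j (1 : ℂ) := by
    rw [Finset.sum_comm, ← Equiv.sum_comp Fin.revPerm, ← Finset.sum_neg_distrib]
    refine Finset.sum_congr rfl fun i _ => ?_
    rw [← Equiv.sum_comp Fin.revPerm, ← Finset.sum_neg_distrib]
    refine Finset.sum_congr rfl fun j _ => ?_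
    simp only [Fin.revPerm_apply, Fin.rev_rev, ← neg_smul]
    rw [hX j.rev i.rev, Fin.rev_rev, Fin.rev_rev, neg_div]
  have h3 : X = ∑ i, ∑ j, X i j • Matrix.single i j (1 : ℂ) := by
    conv_lhs => rw [Matrix.matrix_eq_sum_single X]
    simp
  rw [key, h2, sub_neg_eq_add, ← Finset.sum_add_distrib]
  conv_lhs => rw [h3]
  refine Finset.sum_congr rfl fun i _ => ?_
  rw [← Finset.sum_add_distrib]
  refine Finset.sum_congr rfl fun j _ => ?_
  rw [← add_smul, add_halves]

theorem isRoot_of_ne {i j : Fin 7} (h : j.rev ≠ i) (hij : i ≠ j) :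
    IsRoot fun k => wt k i - wt k j := by
  refine ⟨?_, fun e => F_ne_zero h ?_⟩
  · have : ∀ i j : Fin 7, i ≠ j → (fun k => wt k i - wt k j) ≠ (0 : Fin 3 → ℤ) := by decide
    exact this i j hij
  · have := F_mem_rootSpace i j
    rw [e] at this
    exact (Submodule.mem_bot ℂ).1 this

/-! ### The parabolic subalgebra and the graded pieces -/

/-- The roots with positive `α₂`-coefficient are those having a matrix position in the upper right
`5 × 2` block, possibly after reflection in the antidiagonal. So the parabolic is the stabilizer in
`so7` of the plane of the last two basis vectors. -/
theorem mem_parabolic {X : Mat} :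
    X ∈ parabolic ↔ X ∈ so7 ∧ ∀ i j : Fin 7, i.val ≤ 4 → 5 ≤ j.val → X i j = 0 := by
  constructor
  · let q : Submodule ℂ Mat :=
      { carrier := {X | X ∈ so7 ∧ ∀ i j : Fin 7, i.val ≤ 4 → 5 ≤ j.val → X i j = 0}
        zero_mem' := ⟨so7.zero_mem, by simp⟩
        add_mem' := by
          rintro A B ⟨hA, hA2⟩ ⟨hB, hB2⟩
          exact ⟨so7.add_mem hA hB, fun i j hi hj => by simp [hA2 i j hi hj, hB2 i j hi hj]⟩
        smul_mem' := by
          rintro c A ⟨hA, hA2⟩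
          exact ⟨so7.smul_mem c hA, fun i j hi hj => by simp [hA2 i j hi hj]⟩ }
    have hle : parabolic ≤ q := by
      refine sup_le ?_ (iSup₂_le ?_)
      · rintro H hH
        exact ⟨hH.1, fun i j hi hj => hH.2 i j (by rintro rfl; omega)⟩
      · rintro n ⟨hn, hn2⟩ X hX
        refine ⟨hX.1, fun i j hi hj => ?_⟩
        by_contra hne
        have hw := rootSpace_weight hX hne
        have pos : ∀ i j : Fin 7, i.val ≤ 4 → 5 ≤ j.val →
            (∀ k, 0 ≤ wt k i - wt k j) ∧ 0 < wt 1 i - wt 1 j := by decide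
        obtain ⟨p1, p2⟩ := pos i j hi hj
        exact hn2 (n 1) (by rw [hw]; exact p2) ⟨hn, fun k => by rw [hw]; exact p1 k, rfl⟩
    exact fun h => hle h
  · rintro ⟨hX, hz⟩
    rw [so7_eq_sum hX]
    refine Submodule.sum_mem _ fun i _ => Submodule.sum_mem _ fun j _ => ?_
    by_cases hc : X i j = 0
    · rw [hc, zero_div, zero_smul]; exact Submodule.zero_mem _
    refine Submodule.smul_mem _ _ ?_
    by_cases hrev : j.rev = i
    · rw [← hrev, ← Fin.rev_rev j, Fin.rev_rev j.rev, F_rev_self]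
      exact Submodule.zero_mem _
    by_cases hij : i = j
    · subst hij
      refine Submodule.mem_sup_left ⟨F_mem i i, fun a b hab => ?_⟩
      rw [F_apply, if_neg (fun h => hab (h.1.symm.trans h.2)),
        if_neg (fun h => hab (h.1.symm.trans h.2)), sub_zero]
    · refine Submodule.mem_sup_right (Submodule.mem_iSup_of_mem (fun k => wt k i - wt k j)
        (Submodule.mem_iSup_of_mem ⟨isRoot_of_ne hrev hij, ?_⟩ (F_mem_rootSpace i j)))
      rintro k hk ⟨-, -, h1⟩
      have h1 : wt 1 i - wt 1 j = k := h1
      have hne : X j.rev i.rev ≠ 0 := fun e => hc (by rw [hX i j, e, neg_zero])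
      -- A position of positive degree lies in the block or its mirror image does, and `X` vanishes
      -- there.
      have grade : ∀ i j : Fin 7, 0 < wt 1 i - wt 1 j →
          (i.val ≤ 4 ∧ 5 ≤ j.val) ∨ (j.rev.val ≤ 4 ∧ 5 ≤ i.rev.val) := by decide
      rcases grade i j (h1 ▸ hk) with ⟨a, b⟩ | ⟨a, b⟩
      · exact hc (hz _ _ a b)
      · exact hne (hz _ _ a b)

theorem mPlus_grade {k : ℤ} {X : Mat} (hX : X ∈ mPlus k) :
    X ∈ so7 ∧ ∀ i j : Fin 7, X i j ≠ 0 → wt 1 i - wt 1 j = k := by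
  let q : Submodule ℂ Mat :=
    { carrier := {X | X ∈ so7 ∧ ∀ i j : Fin 7, X i j ≠ 0 → wt 1 i - wt 1 j = k}
      zero_mem' := ⟨so7.zero_mem, by simp⟩
      add_mem' := by
        rintro A B ⟨hA, hA2⟩ ⟨hB, hB2⟩
        refine ⟨so7.add_mem hA hB, fun i j h => ?_⟩
        by_cases h' : A i j = 0
        · exact hB2 i j (by simpa [h'] using h)
        · exact hA2 i j h'
      smul_mem' := by
        rintro c A ⟨hA, hA2⟩
        exact ⟨so7.smul_mem c hA, fun i j h => hA2 i j (right_ne_zero_of_mul h)⟩ }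
  have hle : mPlus k ≤ q := by
    refine iSup₂_le ?_
    rintro n hn X hX
    exact ⟨hX.1, fun i j hij => by rw [← rootSpace_weight hX hij, hn.2.2]⟩
  exact hle hX

theorem F_mem_mPlus {i j : Fin 7} {k : ℤ} (hrev : j.rev ≠ i) (hi : i.val ≤ 4) (hj : 5 ≤ j.val)
    (hk : wt 1 i - wt 1 j = k) : F i j ∈ mPlus k := by
  have pos : ∀ i j : Fin 7, i.val ≤ 4 → 5 ≤ j.val → ∀ k, 0 ≤ wt k i - wt k j := by decide
  refine Submodule.mem_iSup_of_mem (fun k => wt k i - wt k j)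
    (Submodule.mem_iSup_of_mem ?_ (F_mem_rootSpace i j))
  exact ⟨isRoot_of_ne hrev (by rintro rfl; omega), pos i j hi hj, hk⟩

/-! ### Root vectors of `𝔪⁺` and coordinates on `𝔤/𝔭` -/

/-- The rows of the positions of the root vectors `basisVec`. -/
def row (a : Fin 7) : Fin 7 := ![2, 2, 3, 3, 4, 4, 0] a

/-- The columns of the positions of the root vectors `basisVec`. -/
def col (a : Fin 7) : Fin 7 := ![5, 6, 5, 6, 5, 6, 5] a

/-- The root vectors that span a complement of the parabolic subalgebra. -/
def basisVec (a : Fin 7) : Mat := F (row a) (col a)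

/-- The coordinates of a tangent vector with respect to `basisVec`. -/
def coord (X : Mat) (a : Fin 7) : ℂ := X (row a) (col a)

theorem coord_add (X Y : Mat) (a : Fin 7) : coord (X + Y) a = coord X a + coord Y a := rfl

theorem coord_smul (c : ℂ) (X : Mat) (a : Fin 7) : coord (c • X) a = c * coord X a := rfl

theorem coord_sub (X Y : Mat) (a : Fin 7) : coord (X - Y) a = coord X a - coord Y a := rfl

theorem coord_sum {ι : Type*} (s : Finset ι) (f : ι → Mat) (a : Fin 7) :
    coord (∑ i ∈ s, f i) a = ∑ i ∈ s, coord (f i) a := by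
  simp [coord, Matrix.sum_apply]

theorem basisVec_mem (a : Fin 7) : basisVec a ∈ so7 := F_mem _ _

/-- The degree of a root vector. -/
def deg (a : Fin 7) : ℤ := ![1, 1, 1, 1, 1, 1, 2] a

theorem basisVec_mem_mPlus (a : Fin 7) : basisVec a ∈ mPlus (deg a) := by
  have h : ∀ a, (col a).rev ≠ row a ∧ (row a).val ≤ 4 ∧ 5 ≤ (col a).val ∧
    wt 1 (row a) - wt 1 (col a) = deg a := by decide
  exact F_mem_mPlus (h a).1 (h a).2.1 (h a).2.2.1 (h a).2.2.2

theorem coord_basisVec (a b : Fin 7) : coord (basisVec a) b = if a = b then 1 else 0 := by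
  have h1 : ∀ a b, row a = row b ∧ col a = col b ↔ a = b := by decide
  have h2 : ∀ a b, ¬ ((col a).rev = row b ∧ (row a).rev = col b) := by decide
  simp only [coord, basisVec, F_apply, h1, if_neg (h2 a b), sub_zero]

/-- These are the three of the ten block entries that are not coordinates: two are fixed by the
antidiagonal reflection, and the third mirrors the degree-two coordinate. Seven remain, the
dimension of `M`. -/
theorem so7_corner {X : Mat} (hX : X ∈ so7) :
    X 0 6 = 0 ∧ X 1 5 = 0 ∧ X 1 6 = - X 0 5 := by
  have h1 := hX 0 6
  have h2 := hX 1 5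
  have h3 := hX 1 6
  simp only [show Fin.rev (6 : Fin 7) = 0 from rfl, show Fin.rev (0 : Fin 7) = 6 from rfl,
    show Fin.rev (5 : Fin 7) = 1 from rfl, show Fin.rev (1 : Fin 7) = 5 from rfl] at h1 h2 h3
  exact ⟨by linear_combination h1 / 2, by linear_combination h2 / 2, h3⟩

theorem mem_parabolic_of_coord {X : Mat} (hX : X ∈ so7) (h : ∀ a, coord X a = 0) :
    X ∈ parabolic := by
  obtain ⟨c1, c2, c3⟩ := so7_corner hX
  have h6 : X 0 5 = 0 := h 6
  rw [h6, neg_zero] at c3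
  have pos : ∀ i j : Fin 7, i.val ≤ 4 → 5 ≤ j.val → (∃ a, row a = i ∧ col a = j) ∨
      (i = 0 ∧ j = 6) ∨ (i = 1 ∧ j = 5) ∨ (i = 1 ∧ j = 6) := by decide
  refine mem_parabolic.2 ⟨hX, fun i j hi hj => ?_⟩
  rcases pos i j hi hj with ⟨a, rfl, rfl⟩ | ⟨rfl, rfl⟩ | ⟨rfl, rfl⟩ | ⟨rfl, rfl⟩
  · exact h a
  · exact c1
  · exact c2
  · exact c3

theorem coord_eq_zero {X : Mat} (h : X ∈ parabolic) (a : Fin 7) : coord X a = 0 := by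
  have pos : ∀ a, (row a).val ≤ 4 ∧ 5 ≤ (col a).val := by decide
  exact (mem_parabolic.1 h).2 _ _ (pos a).1 (pos a).2

theorem sum_basisVec_mem (c : Fin 7 → ℂ) : ∑ a, c a • basisVec a ∈ so7 :=
  so7.toSubmodule.sum_mem fun a _ => so7.smul_mem _ (basisVec_mem a)

/-- The splitting of `𝔤` into the span of the root vectors and `𝔭`. -/
theorem sub_sum_mem_parabolic {X : Mat} (hX : X ∈ so7) :
    X - ∑ a, coord X a • basisVec a ∈ parabolic := by
  refine mem_parabolic_of_coord (so7.sub_mem hX (sum_basisVec_mem _)) fun b => ?_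
  simp [coord_sub, coord_sum, coord_smul, coord_basisVec]

/-! ### The orthogonal group and its parabolic subgroup -/

/-- The antidiagonal Gram matrix. -/
def gram : Mat := Fin.revPerm.permMatrix ℂ

theorem gram_mul_apply (A : Mat) (i j : Fin 7) : (gram * A) i j = A i.rev j := by
  rw [gram, Equiv.Perm.permMatrix, PEquiv.toMatrix_toPEquiv_mul]
  rfl

theorem mul_gram_apply (A : Mat) (i j : Fin 7) : (A * gram) i j = A i j.rev := by
  rw [gram, Equiv.Perm.permMatrix, PEquiv.mul_toMatrix_toPEquiv]
  rfl

theorem gram_mul_gram : gram * gram = 1 := by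
  ext i j
  rw [gram_mul_apply, ← Matrix.one_mul gram, mul_gram_apply]
  simp [Matrix.one_apply]

theorem mem_so7_iff {X : Mat} : X ∈ so7 ↔ gram * X.transpose * gram = -X := by
  rw [mem_so7, ← Matrix.ext_iff]
  refine forall₂_congr fun i j => ?_
  rw [mul_gram_apply, gram_mul_apply, Matrix.transpose_apply, Matrix.neg_apply]
  constructor <;> intro h <;> rw [h, neg_neg]

theorem SO7_gram (g : SO7) : (toMat g).transpose * gram * toMat g = gram := g.2.1

theorem toMat_mul (g q : SO7) : toMat (g * q) = toMat g * toMat q := rfl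

theorem toMat_one : toMat 1 = 1 := rfl

theorem toMat_mul_inv (g : SO7) : toMat g * toMat g⁻¹ = 1 := by
  rw [← toMat_mul, mul_inv_cancel, toMat_one]

theorem toMat_inv_mul (g : SO7) : toMat g⁻¹ * toMat g = 1 := by
  rw [← toMat_mul, inv_mul_cancel, toMat_one]

theorem toMat_inv (g : SO7) : toMat g⁻¹ = gram * (toMat g).transpose * gram := by
  have h : gram * (toMat g).transpose * gram * toMat g = 1 := by
    rw [mul_assoc, mul_assoc, ← mul_assoc _ gram, SO7_gram, gram_mul_gram]
  calc toMat g⁻¹ = (gram * (toMat g).transpose * gram * toMat g) * toMat g⁻¹ := by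
        rw [h, one_mul]
    _ = _ := by rw [mul_assoc _ (toMat g), toMat_mul_inv, mul_one]

theorem toMat_inv_apply (g : SO7) (a b : Fin 7) : toMat g⁻¹ a b = toMat g b.rev a.rev := by
  rw [toMat_inv, mul_gram_apply, gram_mul_apply, Matrix.transpose_apply]

theorem Ad_mem_so7 (g : SO7) {X : Mat} (hX : X ∈ so7) : Ad g X ∈ so7 := by
  rw [mem_so7_iff] at hX ⊢
  have h1 : (toMat g).transpose = gram * toMat g⁻¹ * gram := by
    have := toMat_inv g
    rw [this]
    simp only [← mul_assoc, gram_mul_gram, one_mul]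
    rw [mul_assoc, gram_mul_gram, mul_one]
  have h2 : (toMat g⁻¹).transpose = gram * toMat g * gram := by
    have := toMat_inv g⁻¹
    rw [inv_inv] at this
    rw [this]
    simp only [← mul_assoc, gram_mul_gram, one_mul]
    rw [mul_assoc, gram_mul_gram, mul_one]
  simp only [Ad, Matrix.transpose_mul, h1, h2]
  calc _ = (gram * gram) * toMat g * (gram * X.transpose * gram) * toMat g⁻¹ * (gram * gram) := by
        simp only [mul_assoc]
    _ = _ := by rw [gram_mul_gram, hX]; simp

theorem Ad_smul (g : SO7) (c : ℂ) (X : Mat) : Ad g (c • X) = c • Ad g X := by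
  simp [Ad]

theorem Ad_sub (g : SO7) (X Y : Mat) : Ad g (X - Y) = Ad g X - Ad g Y := by
  simp [Ad, mul_sub, sub_mul]

theorem Ad_sum (g : SO7) {ι : Type*} (s : Finset ι) (f : ι → Mat) :
    Ad g (∑ i ∈ s, f i) = ∑ i ∈ s, Ad g (f i) := by
  simp [Ad, Finset.mul_sum, Finset.sum_mul]

theorem inv_lower {q : SO7} (hq : ∀ i j : Fin 7, i < j → toMat q i j = 0) (i j : Fin 7)
    (hij : i < j) : toMat q⁻¹ i j = 0 := by
  rw [toMat_inv_apply]
  exact hq _ _ (Fin.rev_lt_rev.2 hij)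

theorem Ad_lower_mem {q : SO7} (hq : ∀ i j : Fin 7, i < j → toMat q i j = 0) {X : Mat}
    (hX : X ∈ parabolic) : Ad q X ∈ parabolic := by
  rw [mem_parabolic] at hX ⊢
  refine ⟨Ad_mem_so7 q hX.1, fun i j hi hj => ?_⟩
  rw [Ad, Matrix.mul_apply]
  refine Finset.sum_eq_zero fun l _ => ?_
  by_cases hl : l < j
  · rw [inv_lower hq _ _ hl, mul_zero]
  · rw [Matrix.mul_apply, Finset.sum_eq_zero, zero_mul]
    intro k _
    by_cases hk : i < k
    · rw [hq _ _ hk, zero_mul]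
    · rw [hX.2 k l (by omega) (by omega), mul_zero]

/-- With the present sign convention `𝔭` contains the lower triangular Borel subalgebra; conjugation
by a lower triangular matrix keeps the upper right block zero, and so does its inverse. -/
theorem mem_P_of_lower {q : SO7} (hq : ∀ i j : Fin 7, i < j → toMat q i j = 0) : q ∈ P := by
  intro X
  refine ⟨fun h => ?_, Ad_lower_mem hq⟩
  have := Ad_lower_mem (q := q⁻¹) (inv_lower hq) h
  rwa [← Ad_mul, inv_mul_cancel, Ad_one] at this

/-- The trace form pairs the `F a b` with matrix entries, which allows passing from `Ad q` to its
adjoint `Ad q⁻¹` in `P_block`. -/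
theorem trace_mul_F {X : Mat} (hX : X ∈ so7) (a b : Fin 7) : (X * F a b).trace = 2 * X b a := by
  rw [F, mul_sub, Matrix.trace_sub, Matrix.trace_mul_single, Matrix.trace_mul_single,
    hX b a]
  simp
  ring

theorem F_mem_parabolic {j : Fin 7} (hj : 5 ≤ j.val) (i : Fin 7) : F j i ∈ parabolic := by
  refine mem_parabolic.2 ⟨F_mem j i, fun a b ha hb => ?_⟩
  rw [F_apply, if_neg, if_neg, sub_zero]
  · rintro ⟨-, rfl⟩
    rw [Fin.val_rev] at hb
    omega
  · rintro ⟨rfl, -⟩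
    omega

/-- The normalizer of `𝔭` preserves the plane. Since `Ad q` keeps each `F j k` in `𝔭`, duality for
the trace form shows that column `j` of `Ad q⁻¹ (F r i)` vanishes; row `r` of `F r i * q = q * Ad
q⁻¹ (F r i)` then isolates the wanted entry. -/
theorem P_block {q : SO7} (hq : q ∈ P) (i j : Fin 7) (hi : i.val ≤ 4) (hj : 5 ≤ j.val) :
    toMat q i j = 0 := by
  -- Avoiding `i'` keeps the mirror entry of `F r i` out of row `r`; two candidates for `r` suffice.
  obtain ⟨r, hr, hri⟩ : ∃ r : Fin 7, 5 ≤ r.val ∧ i.rev ≠ r := by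
    revert i; decide
  have hW : ∀ k, Ad q⁻¹ (F r i) k j = 0 := by
    intro k
    have h1 := trace_mul_F (Ad_mem_so7 q⁻¹ (F_mem r i)) j k
    have h2 : (Ad q⁻¹ (F r i) * F j k).trace = (Ad q (F j k) * F r i).trace := by
      simp only [Ad, inv_inv]
      rw [mul_assoc, mul_assoc, Matrix.trace_mul_comm, mul_assoc, Matrix.trace_mul_comm]
    have h3 := (hq _).2 (F_mem_parabolic hj k)
    rw [h2, trace_mul_F (Ad_mem_so7 q (F_mem j k)), (mem_parabolic.1 h3).2 i r hi hr] at h1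
    simpa using h1.symm
  have h4 : F r i * toMat q = toMat q * Ad q⁻¹ (F r i) := by
    rw [Ad, inv_inv, ← mul_assoc, ← mul_assoc, toMat_mul_inv, one_mul]
  have h5 := congrFun (congrFun h4 r) j
  rw [Matrix.mul_apply, Matrix.mul_apply] at h5
  simp only [hW, mul_zero, Finset.sum_const_zero] at h5
  rw [Finset.sum_eq_single i] at h5
  · rwa [F_apply, if_pos ⟨rfl, rfl⟩, if_neg, sub_zero, one_mul] at h5
    rintro ⟨h, -⟩
    exact hri h
  · intro b _ hb
    rw [F_apply, if_neg (fun h => hb h.2.symm), if_neg, sub_zero, zero_mul]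
    rintro ⟨h, -⟩
    exact hri h
  · simp

/-! ### The Iwasawa decomposition -/

open scoped ComplexOrder in
-- Gram–Schmidt alters the `i`-th basis vector only by earlier vectors, whose `i`-th coordinate is
-- zero.
theorem LDL_lowerInv_diag {n : ℕ} {S : Matrix (Fin n) (Fin n) ℂ} (hS : S.PosDef) (i : Fin n) :
    LDL.lowerInv hS i i = 1 := by
  let := (S.transpose.toNormedAddCommGroup hS.transpose)
  let := (S.transpose.toInnerProductSpace hS.transpose.posSemidef)
  have h := InnerProductSpace.gramSchmidt_def'' ℂ (Pi.basisFun ℂ (Fin n)) i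
  have h := congrFun h i
  rw [Pi.add_apply, Finset.sum_apply, Finset.sum_eq_zero, add_zero] at h
  · rw [LDL.lowerInv, ← h]
    simp
  · intro j hj
    have : InnerProductSpace.gramSchmidt ℂ (Pi.basisFun ℂ (Fin n)) j i = 0 :=
      LDL.lowerInv_triangular hS (Finset.mem_Iio.1 hj)
    rw [Pi.smul_apply, this, smul_zero]

open scoped ComplexOrder in
/-- Every invertible matrix is the product of a unitary matrix and a lower triangular matrix with
positive diagonal entries. -/
theorem exists_unitary_mul_lower {n : ℕ} (g : Matrix (Fin n) (Fin n) ℂ) (hg : IsUnit g) :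
    ∃ u ∈ Matrix.unitaryGroup (Fin n) ℂ, ∃ b : Matrix (Fin n) (Fin n) ℂ, g = u * b ∧
      (∀ i j, i < j → b i j = 0) ∧ ∀ i, 0 < b i i := by
  have hdet := (Matrix.isUnit_iff_isUnit_det _).1 hg
  -- If `L S L* = D` is the LDL decomposition of `S = g⁻¹ g⁻*`, then `v = D^{-1/2} L g⁻¹` is unitary
  -- and `v g = D^{-1/2} L` is lower triangular with positive diagonal.
  have hS : (g⁻¹ * (g⁻¹).conjTranspose).PosDef :=
    Matrix.PosDef.mul_conjTranspose_self _
      (Matrix.vecMul_injective_of_isUnit ((Matrix.isUnit_nonsing_inv_iff).2 hg))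
  set L := LDL.lowerInv hS with hL
  have hLdet : IsUnit L.det := Matrix.isUnit_det_of_invertible _
  have hdiag := LDL.diag_eq_lowerInv_conj hS
  rw [← hL] at hdiag
  have hd : ∀ i, 0 < LDL.diagEntries hS i := by
    intro i
    have h1 : (LDL.diag hS).PosDef := by
      rw [hdiag]
      exact hS.mul_mul_conjTranspose_same (Matrix.vecMul_injective_of_isUnit
        ((Matrix.isUnit_iff_isUnit_det _).2 hLdet))
    simpa [LDL.diag] using h1.diag_pos (i := i)
  set r : Fin n → ℝ := fun i => √(LDL.diagEntries hS i).re with hr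
  have hr0 : ∀ i, 0 < r i := fun i => Real.sqrt_pos.2 (Complex.pos_iff.1 (hd i)).1
  have hr2 : ∀ i, ((r i : ℂ)) * r i = LDL.diagEntries hS i := by
    intro i
    obtain ⟨h1, h2⟩ := Complex.pos_iff.1 (hd i)
    rw [← Complex.ofReal_mul, Real.mul_self_sqrt h1.le]
    exact Complex.ext rfl h2
  set R : Matrix (Fin n) (Fin n) ℂ := Matrix.diagonal fun i => ((r i)⁻¹ : ℂ) with hR
  have hRH : R.conjTranspose = R := by
    rw [hR, Matrix.diagonal_conjTranspose]
    congr 1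
    ext i
    simp
  have hRD : R * LDL.diag hS * R = 1 := by
    rw [hR, LDL.diag, Matrix.diagonal_mul_diagonal, Matrix.diagonal_mul_diagonal,
      ← Matrix.diagonal_one]
    congr 1
    ext i
    rw [← hr2]
    have : (r i : ℂ) ≠ 0 := Complex.ofReal_ne_zero.2 (hr0 i).ne'
    field_simp
  set v := R * L * g⁻¹ with hv
  have hvv : v * v.conjTranspose = 1 := by
    rw [← hRD, hdiag, hv]
    simp only [Matrix.conjTranspose_mul, hRH, mul_assoc]
  have hvg : v * g = R * L := by
    rw [hv, mul_assoc, Matrix.nonsing_inv_mul _ hdet, mul_one]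
  refine ⟨star v, ?_, R * L, ?_, fun i j hij => ?_, fun i => ?_⟩
  · exact Unitary.star_mem (Matrix.mem_unitaryGroup_iff.2 hvv)
  · rw [← hvg, ← mul_assoc, Matrix.star_eq_conjTranspose, mul_eq_one_comm.1 hvv, one_mul]
  · rw [hR, Matrix.diagonal_mul, hL, LDL.lowerInv_triangular hS hij, mul_zero]
  · rw [hR, Matrix.diagonal_mul, hL, LDL_lowerInv_diag, mul_one, ← Complex.ofReal_inv]
    exact Complex.zero_lt_real.2 (inv_pos.2 (hr0 i))

open scoped ComplexOrder in
/-- A lower triangular unitary matrix with positive diagonal entries is the identity. -/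
theorem eq_one_of_unitary_lower {n : ℕ} {w : Matrix (Fin n) (Fin n) ℂ}
    (hw : w ∈ Matrix.unitaryGroup (Fin n) ℂ) (hl : ∀ i j, i < j → w i j = 0)
    (hp : ∀ i, 0 < w i i) : w = 1 := by
  have h1 : w.conjTranspose * w = 1 := Matrix.mem_unitaryGroup_iff'.1 hw
  have hinv : w⁻¹ = w.conjTranspose := Matrix.inv_eq_left_inv h1
  have : Invertible w := invertibleOfLeftInverse _ _ h1
  have htri : w.BlockTriangular OrderDual.toDual := fun i j hij => hl i j hij
  have htri' := Matrix.blockTriangular_inv_of_blockTriangular htri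
  -- The inverse is lower triangular and also equals the conjugate transpose, so `w` is diagonal.
  have hoff : ∀ i j, i ≠ j → w i j = 0 := by
    intro i j hij
    rcases lt_or_gt_of_ne hij with h | h
    · exact hl i j h
    · have := htri' (i := j) (j := i) h
      rw [hinv, Matrix.conjTranspose_apply] at this
      exact star_eq_zero.1 this
  have hdiag : ∀ i, w i i = 1 := by
    intro i
    have h2 := congrFun (congrFun h1 i) i
    rw [Matrix.mul_apply, Finset.sum_eq_single i, Matrix.conjTranspose_apply,
      Matrix.one_apply_eq] at h2
    · obtain ⟨h3, h4⟩ := Complex.pos_iff.1 (hp i)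
      have h5 : w i i = ((w i i).re : ℂ) := Complex.ext rfl (by simpa using h4.symm)
      rw [h5] at h2 ⊢
      rw [Complex.star_def, Complex.conj_ofReal, ← Complex.ofReal_mul] at h2
      have h6 : (w i i).re * (w i i).re = 1 := by exact_mod_cast h2
      have h7 : (w i i).re = 1 := by nlinarith
      rw [h7, Complex.ofReal_one]
    · intro k _ hk
      rw [hoff k i hk, mul_zero]
    · simp
  ext i j
  by_cases hij : i = j
  · subst hij
    rw [hdiag, Matrix.one_apply_eq]
  · rw [hoff i j hij, Matrix.one_apply_ne hij]

theorem gram_mem_unitary : gram ∈ Matrix.unitaryGroup (Fin 7) ℂ := by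
  rw [Matrix.mem_unitaryGroup_iff]
  have : star gram = gram := by
    ext i j
    rw [Matrix.star_apply, ← Matrix.one_mul gram, mul_gram_apply, mul_gram_apply,
      Matrix.one_apply, Matrix.one_apply]
    have : j = i.rev ↔ i = j.rev := by rw [eq_comm, Fin.rev_eq_iff, eq_comm]
    simp only [this]
    split_ifs <;> simp
  rw [this, gram_mul_gram]

open scoped ComplexOrder in
/-- The compact form acts transitively on `G/P`. -/
theorem exists_compact_mul_parabolic (g : SO7) : ∃ u ∈ compactForm, ∃ q ∈ P, g = u * q := by
  have hgu : IsUnit (toMat g) := ⟨g.1, rfl⟩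
  obtain ⟨u, hu, b, hub, hb, hbp⟩ := exists_unitary_mul_lower (toMat g) hgu
  have hu1 : u * star u = 1 := Matrix.mem_unitaryGroup_iff.1 hu
  have hu2 : star u * u = 1 := Matrix.mem_unitaryGroup_iff'.1 hu
  have hb1 : star u * toMat g = b := by rw [hub, ← mul_assoc, hu2, one_mul]
  -- the inverse of the triangular factor
  have hbc : b * (toMat g⁻¹ * u) = 1 := by
    rw [← hb1, ← mul_assoc, mul_assoc (star u), toMat_mul_inv, mul_one, hu2]
  set c := toMat g⁻¹ * u with hc
  have hcb : c * b = 1 := mul_eq_one_comm.1 hbc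
  have hcl : ∀ i j, i < j → c i j = 0 := by
    have : Invertible b := invertibleOfLeftInverse _ _ hcb
    have htri : b.BlockTriangular OrderDual.toDual := fun i j hij => hb i j hij
    have htri' := Matrix.blockTriangular_inv_of_blockTriangular htri
    rw [Matrix.inv_eq_left_inv hcb] at htri'
    exact fun i j hij => htri' (i := i) (j := j) hij
  have hmul : ∀ (x y : Mat), (∀ i j, i < j → x i j = 0) → (∀ i j, i < j → y i j = 0) →
      (∀ i j, i < j → (x * y) i j = 0) ∧ ∀ i, (x * y) i i = x i i * y i i := by
    intro x y hx hy
    refine ⟨fun i j hij => ?_, fun i => ?_⟩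
    · rw [Matrix.mul_apply]
      refine Finset.sum_eq_zero fun k _ => ?_
      by_cases hk : i < k
      · rw [hx _ _ hk, zero_mul]
      · rw [hy _ _ (lt_of_le_of_lt (not_lt.1 hk) hij), mul_zero]
    · rw [Matrix.mul_apply, Finset.sum_eq_single i]
      · intro k _ hk
        rcases lt_or_gt_of_ne hk with h | h
        · rw [hy _ _ h, mul_zero]
        · rw [hx _ _ h, zero_mul]
      · simp
  have hcp : ∀ i, 0 < c i i := by
    intro i
    have h1 := (hmul b c hb hcl).2 i
    rw [hbc, Matrix.one_apply_eq] at h1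
    rw [eq_inv_of_mul_eq_one_right h1.symm]
    exact RCLike.inv_pos_of_pos (hbp i)
  -- the Gram matrix of `u`
  set d := gram * c.transpose * gram with hd
  have hda : ∀ i j, d i j = c j.rev i.rev := by
    intro i j
    rw [hd, mul_gram_apply, gram_mul_apply, Matrix.transpose_apply]
  have hdl : ∀ i j, i < j → d i j = 0 := fun i j hij => by
    rw [hda]; exact hcl _ _ (Fin.rev_lt_rev.2 hij)
  -- The left side is lower triangular with positive diagonal and the right side is unitary, so both
  -- are the identity. Thus the unitary factor preserves the bilinear form.
  have hw : d * c = gram * (u.transpose * gram * u) := by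
    have h1 : gram * (toMat g⁻¹).transpose * gram * toMat g⁻¹ = 1 := by
      rw [mul_assoc, mul_assoc, ← mul_assoc _ gram, SO7_gram, gram_mul_gram]
    have h2 := SO7_gram g⁻¹
    rw [hd, hc, Matrix.transpose_mul]
    calc _ = gram * (u.transpose * ((toMat g⁻¹).transpose * gram * toMat g⁻¹) * u) := by
          simp only [mul_assoc]
      _ = _ := by rw [h2]
  have hut : u.transpose ∈ Matrix.unitaryGroup (Fin 7) ℂ := by
    rw [Matrix.mem_unitaryGroup_iff]
    change u.transpose * (star u).transpose = 1
    rw [← Matrix.transpose_mul, hu2, Matrix.transpose_one]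
  have hone : d * c = 1 := by
    refine eq_one_of_unitary_lower ?_ (hmul d c hdl hcl).1 fun i => ?_
    · rw [hw]
      exact mul_mem gram_mem_unitary (mul_mem (mul_mem hut gram_mem_unitary) hu)
    · rw [(hmul d c hdl hcl).2, hda]
      exact mul_pos (hcp _) (hcp _)
  have hgram : u.transpose * gram * u = gram := by
    rw [hw] at hone
    have := congrArg (gram * ·) hone
    simpa only [← mul_assoc, gram_mul_gram, one_mul, mul_one] using this
  -- The determinant is positive, being inverse to that of `b`, and has modulus one.
  have hdet : u.det = 1 := by
    have h1 : u.det * b.det = 1 := by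
      rw [← Matrix.det_mul, ← hub]
      exact g.2.2
    have h2 : b.det = ∏ i, b i i := Matrix.det_of_isLowerTriangular b fun i j hij => hb i j hij
    have h3 : 0 < b.det := by
      rw [h2]
      exact Finset.prod_pos fun i _ => hbp i
    have h4 : 0 < u.det := by
      rw [eq_inv_of_mul_eq_one_left h1]
      exact RCLike.inv_pos_of_pos h3
    have h5 : star u.det * u.det = 1 := by
      rw [← Matrix.det_conjTranspose, ← Matrix.det_mul, ← Matrix.star_eq_conjTranspose, hu2,
        Matrix.det_one]
    obtain ⟨h6, h7⟩ := Complex.pos_iff.1 h4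
    have h8 : u.det = (u.det.re : ℂ) := Complex.ext rfl (by simpa using h7.symm)
    rw [h8, Complex.star_def, Complex.conj_ofReal, ← Complex.ofReal_mul] at h5
    have h9 : u.det.re * u.det.re = 1 := by exact_mod_cast h5
    rw [h8, show u.det.re = 1 by nlinarith, Complex.ofReal_one]
  let U : SO7 := ⟨⟨u, star u, hu1, hu2⟩, hgram, hdet⟩
  refine ⟨U, hu, U⁻¹ * g, mem_P_of_lower ?_, (mul_inv_cancel_left U g).symm⟩
  have : toMat (U⁻¹ * g) = b := hb1
  rw [this]
  exact hb

/-! ### Sesquilinear forms on the tangent space -/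

/-- `β` is a sesquilinear form on `𝔤/𝔭`. -/
structure IsTangentForm (β : Mat → Mat → ℂ) : Prop where
  add_left : ∀ X ∈ so7, ∀ X₂ ∈ so7, ∀ Y ∈ so7, β (X + X₂) Y = β X Y + β X₂ Y
  smul_left : ∀ c : ℂ, ∀ X ∈ so7, ∀ Y ∈ so7, β (c • X) Y = c * β X Y
  add_right : ∀ X ∈ so7, ∀ Y ∈ so7, ∀ Y₂ ∈ so7, β X (Y + Y₂) = β X Y + β X Y₂
  smul_right : ∀ c : ℂ, ∀ X ∈ so7, ∀ Y ∈ so7, β X (c • Y) = conj c * β X Y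
  parabolic_left : ∀ X ∈ parabolic, ∀ Y ∈ so7, β X Y = 0
  parabolic_right : ∀ X ∈ so7, ∀ Y ∈ parabolic, β X Y = 0

/-- The matrix of a sesquilinear form with respect to `basisVec`. -/
def formMatrix (β : Mat → Mat → ℂ) : Mat := Matrix.of fun a b => β (basisVec a) (basisVec b)

theorem parabolic_le {X : Mat} (hX : X ∈ parabolic) : X ∈ so7 := (mem_parabolic.1 hX).1

theorem sum_smul_mem {ι : Type*} (s : Finset ι) (c : ι → ℂ) {v : ι → Mat}
    (hv : ∀ i, v i ∈ so7) : ∑ i ∈ s, c i • v i ∈ so7 :=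
  so7.toSubmodule.sum_mem fun a _ => so7.smul_mem _ (hv a)

namespace IsTangentForm

variable {β : Mat → Mat → ℂ} (hβ : IsTangentForm β)
include hβ

theorem sum_left {ι : Type*} (s : Finset ι) (c : ι → ℂ) {v : ι → Mat} (hv : ∀ i, v i ∈ so7)
    {Y : Mat} (hY : Y ∈ so7) : β (∑ i ∈ s, c i • v i) Y = ∑ i ∈ s, c i * β (v i) Y := by
  classical
  induction s using Finset.induction_on with
  | empty =>
    simpa using hβ.smul_left 0 0 so7.zero_mem Y hY
  | insert i s hi ih =>
    rw [Finset.sum_insert hi, Finset.sum_insert hi,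
      hβ.add_left _ (so7.smul_mem _ (hv i)) _ (sum_smul_mem s c hv) _ hY,
      hβ.smul_left _ _ (hv i) _ hY, ih]

theorem sum_right {ι : Type*} (s : Finset ι) (c : ι → ℂ) {v : ι → Mat} (hv : ∀ i, v i ∈ so7)
    {X : Mat} (hX : X ∈ so7) :
    β X (∑ i ∈ s, c i • v i) = ∑ i ∈ s, conj (c i) * β X (v i) := by
  classical
  induction s using Finset.induction_on with
  | empty =>
    simpa using hβ.smul_right 0 X hX 0 so7.zero_mem
  | insert i s hi ih =>
    rw [Finset.sum_insert hi, Finset.sum_insert hi,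
      hβ.add_right _ hX _ (so7.smul_mem _ (hv i)) _ (sum_smul_mem s c hv),
      hβ.smul_right _ _ hX _ (hv i), ih]

theorem eq_sum {X Y : Mat} (hX : X ∈ so7) (hY : Y ∈ so7) :
    β X Y = ∑ a, ∑ b, coord X a * formMatrix β a b * conj (coord Y b) := by
  have h1 : β X Y = β (∑ a, coord X a • basisVec a) Y := by
    conv_lhs => rw [← sub_add_cancel X (∑ a, coord X a • basisVec a)]
    rw [hβ.add_left _ (parabolic_le (sub_sum_mem_parabolic hX)) _ (sum_basisVec_mem _) _ hY,
      hβ.parabolic_left _ (sub_sum_mem_parabolic hX) _ hY, zero_add]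
  rw [h1, hβ.sum_left _ _ basisVec_mem hY]
  refine Finset.sum_congr rfl fun a _ => ?_
  have h2 : β (basisVec a) Y = β (basisVec a) (∑ b, coord Y b • basisVec b) := by
    conv_lhs => rw [← sub_add_cancel Y (∑ b, coord Y b • basisVec b)]
    rw [hβ.add_right _ (basisVec_mem a) _ (parabolic_le (sub_sum_mem_parabolic hY)) _
      (sum_basisVec_mem _), hβ.parabolic_right _ (basisVec_mem a) _ (sub_sum_mem_parabolic hY),
      zero_add]
  rw [h2, hβ.sum_right _ _ basisVec_mem (basisVec_mem a), Finset.mul_sum]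
  refine Finset.sum_congr rfl fun b _ => ?_
  simp only [formMatrix, Matrix.of_apply]
  ring

/-- The Gram matrix of a family of vectors. -/
theorem gram_eq {ι : Type*} {v w : ι → Mat} (hv : ∀ i, v i ∈ so7) (hw : ∀ i, w i ∈ so7) :
    (Matrix.of fun i j => β (v i) (w j)) =
      (Matrix.of fun i a => coord (v i) a) * formMatrix β *
        (Matrix.of fun i a => coord (w i) a).conjTranspose := by
  ext i j
  rw [Matrix.of_apply, hβ.eq_sum (hv i) (hw j), Matrix.mul_apply, Finset.sum_comm]
  refine Finset.sum_congr rfl fun b _ => ?_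
  rw [Matrix.mul_apply, Finset.sum_mul]
  rfl

end IsTangentForm

/-- The matrix of the action of `q` on the tangent space. -/
def adMatrix (q : SO7) : Mat := Matrix.of fun a b => coord (Ad q (basisVec a)) b

/-- Since `Ad q⁻¹` maps `𝔭` to itself, the error made by truncating to coordinates stays in `𝔭`. -/
theorem adMatrix_mul_inv {q : SO7} (hq : q ∈ P) : adMatrix q * adMatrix q⁻¹ = 1 := by
  ext a b
  have hY := Ad_mem_so7 q (basisVec_mem a)
  have h1 := (P.inv_mem hq _).2 (sub_sum_mem_parabolic hY)
  have h2 := coord_eq_zero h1 b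
  rw [Ad_sub, Ad_sum, ← Ad_mul, inv_mul_cancel, Ad_one, coord_sub, coord_sum,
    coord_basisVec, sub_eq_zero] at h2
  rw [Matrix.mul_apply, Matrix.one_apply, h2]
  refine Finset.sum_congr rfl fun c _ => ?_
  rw [Ad_smul, coord_smul]
  rfl

theorem adMatrix_isUnit {q : SO7} (hq : q ∈ P) : IsUnit (adMatrix q).det :=
  Matrix.isUnit_det_of_right_inverse (adMatrix_mul_inv hq)

/-! ### The pulled back Fubini–Study form -/

/-- `7 × 2` matrices. -/
abbrev Mat2 := Matrix (Fin 7) (Fin 2) ℂ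

/-- The last two columns of the identity matrix. -/
def emb : Mat2 := Matrix.of fun i a => if i = Fin.natAdd 5 a then 1 else 0

/-- The inverse Gram matrix of the columns of `A`. -/
def gramInv (A : Mat2) : Matrix (Fin 2) (Fin 2) ℂ := (A.conjTranspose * A)⁻¹

/-- The products of `B` and `C`, normalized by the Gram matrix of `A`. -/
def relGram (A B C : Mat2) : Matrix (Fin 2) (Fin 2) ℂ := gramInv A * (B.conjTranspose * C)

/-- The Fubini–Study form `∂∂̄ log det (A* A)` on the tangent vectors `B`, `C` at `A`. -/
def fsForm (A B C : Mat2) : ℂ :=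
  (relGram A C B).trace - (relGram A C A * relGram A A B).trace

/-- The form `∂̄ log det (A* A)` on the tangent vector `C` at `A`. -/
def fsPrim (A C : Mat2) : ℂ := (relGram A C A).trace

/-- The antiholomorphic derivative of `fsForm` at `A` in the direction `D`, where `C` has the
derivative `C'`. -/
def fsDeriv (A D B C C' : Mat2) : ℂ :=
  - (relGram A D A * relGram A C B).trace + (relGram A C' B).trace
  + (relGram A D A * relGram A C A * relGram A A B).trace
  - (relGram A C' A * relGram A A B).trace
  + (relGram A C A * relGram A D A * relGram A A B).trace
  - (relGram A C A * relGram A D B).trace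

/-- The vectors spanning the isotropic plane at `g`. -/
def frame (g : SO7) (X : Mat) : Mat2 := toMat g * X * emb

/-- The canonical metric of `G/P`. -/
def canonicalForm : Form := fun g X Y => fsForm (frame g 1) (frame g X) (frame g Y)

/-- The antiholomorphic derivative of the canonical metric in the direction `Z`, on constant
vectors. -/
def canonicalDeriv (g : SO7) (Z X Y : Mat) : ℂ :=
  fsDeriv (frame g 1) (frame g Z) (frame g X) (frame g Y) (frame g (Z * Y))

theorem unitary_gram {u : Mat} (hu : u.conjTranspose * u = 1) (A B : Mat2) :
    (u * A).conjTranspose * (u * B) = A.conjTranspose * B := by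
  rw [Matrix.conjTranspose_mul, Matrix.mul_assoc, ← Matrix.mul_assoc _ u, hu, Matrix.one_mul]

/-- Only products of the form `B* C` occur, and an isometry on the left cancels in them; this is the
source of `G_u`-invariance. -/
theorem relGram_unitary {u : Mat} (hu : u.conjTranspose * u = 1) (A B C : Mat2) :
    relGram (u * A) (u * B) (u * C) = relGram A B C := by
  simp only [relGram, gramInv, unitary_gram hu]

theorem fsForm_unitary {u : Mat} (hu : u.conjTranspose * u = 1) (A B C : Mat2) :
    fsForm (u * A) (u * B) (u * C) = fsForm A B C := by
  simp only [fsForm, relGram_unitary hu]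

theorem fsPrim_unitary {u : Mat} (hu : u.conjTranspose * u = 1) (A C : Mat2) :
    fsPrim (u * A) (u * C) = fsPrim A C := by
  simp only [fsPrim, relGram_unitary hu]

theorem fsDeriv_unitary {u : Mat} (hu : u.conjTranspose * u = 1) (A D B C C' : Mat2) :
    fsDeriv (u * A) (u * D) (u * B) (u * C) (u * C') = fsDeriv A D B C C' := by
  simp only [fsDeriv, relGram_unitary hu]

theorem mul_gram_right (w : Matrix (Fin 2) (Fin 2) ℂ) (A B : Mat2) :
    (A * w).conjTranspose * (B * w) = w.conjTranspose * (A.conjTranspose * B) * w := by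
  simp only [Matrix.conjTranspose_mul, Matrix.mul_assoc]

theorem gramInv_mul {w : Matrix (Fin 2) (Fin 2) ℂ} (A : Mat2) :
    gramInv (A * w) = w⁻¹ * gramInv A * w.conjTranspose⁻¹ := by
  rw [gramInv, mul_gram_right, Matrix.mul_inv_rev, Matrix.mul_inv_rev, gramInv, mul_assoc]

/-- A change of frame only conjugates the normalized Gram matrices, so traces of their products
depend on the plane alone. -/
theorem relGram_mul {w : Matrix (Fin 2) (Fin 2) ℂ} (hw : IsUnit w.det) (A B C : Mat2) :
    relGram (A * w) (B * w) (C * w) = w⁻¹ * relGram A B C * w := by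
  have h : IsUnit w.conjTranspose.det := by
    rw [Matrix.det_conjTranspose]; exact hw.star
  rw [relGram, gramInv_mul, mul_gram_right, relGram]
  calc _ = w⁻¹ * gramInv A * (w.conjTranspose⁻¹ * w.conjTranspose) *
        (B.conjTranspose * C) * w := by simp only [mul_assoc]
    _ = _ := by rw [Matrix.nonsing_inv_mul _ h]; simp only [mul_assoc, one_mul]

theorem trace_conj {w : Matrix (Fin 2) (Fin 2) ℂ} (hw : IsUnit w.det)
    (x : Matrix (Fin 2) (Fin 2) ℂ) : (w⁻¹ * x * w).trace = x.trace := by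
  rw [Matrix.trace_mul_comm, ← mul_assoc, Matrix.mul_nonsing_inv _ hw, one_mul]

theorem conj_mul_conj {w : Matrix (Fin 2) (Fin 2) ℂ} (hw : IsUnit w.det)
    (x y : Matrix (Fin 2) (Fin 2) ℂ) : (w⁻¹ * x * w) * (w⁻¹ * y * w) = w⁻¹ * (x * y) * w := by
  calc _ = w⁻¹ * x * (w * w⁻¹) * y * w := by simp only [mul_assoc]
    _ = _ := by rw [Matrix.mul_nonsing_inv _ hw, mul_one]; simp only [mul_assoc]

theorem fsForm_mul {w : Matrix (Fin 2) (Fin 2) ℂ} (hw : IsUnit w.det) (A B C : Mat2) :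
    fsForm (A * w) (B * w) (C * w) = fsForm A B C := by
  simp only [fsForm, relGram_mul hw, conj_mul_conj hw, trace_conj hw]

theorem fsPrim_mul {w : Matrix (Fin 2) (Fin 2) ℂ} (hw : IsUnit w.det) (A C : Mat2) :
    fsPrim (A * w) (C * w) = fsPrim A C := by
  simp only [fsPrim, relGram_mul hw, trace_conj hw]

theorem fsDeriv_mul {w : Matrix (Fin 2) (Fin 2) ℂ} (hw : IsUnit w.det) (A D B C C' : Mat2) :
    fsDeriv (A * w) (D * w) (B * w) (C * w) (C' * w) = fsDeriv A D B C C' := by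
  simp only [fsDeriv, relGram_mul hw, conj_mul_conj hw, trace_conj hw]

theorem mul_emb_apply {n : Type*} (X : Matrix n (Fin 7) ℂ) (i : n) (a : Fin 2) :
    (X * emb) i a = X i (Fin.natAdd 5 a) := by
  simp [Matrix.mul_apply, emb]

theorem conjTranspose_emb_mul_apply {n : Type*} (X : Matrix (Fin 7) n ℂ) (a : Fin 2) (i : n) :
    (emb.conjTranspose * X) a i = X (Fin.natAdd 5 a) i := by
  simp [Matrix.mul_apply, emb, Matrix.conjTranspose_apply, apply_ite]

theorem emb_gram : emb.conjTranspose * emb = 1 := by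
  ext a b
  rw [conjTranspose_emb_mul_apply, emb, Matrix.of_apply, Matrix.one_apply]
  have h : ∀ a b : Fin 2, Fin.natAdd 5 b = Fin.natAdd 5 a ↔ a = b := by decide
  simp only [h, eq_comm]

/-- A matrix preserving the isotropic plane acts on it by its lower right block. -/
theorem mul_emb_of_block {X : Mat}
    (hX : ∀ i j : Fin 7, i.val ≤ 4 → 5 ≤ j.val → X i j = 0) :
    X * emb = emb * (emb.conjTranspose * X * emb) := by
  ext i a
  rw [mul_emb_apply, Matrix.mul_apply]
  simp only [mul_emb_apply, conjTranspose_emb_mul_apply]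
  by_cases hi : i.val ≤ 4
  · rw [hX _ _ hi (by simp), Finset.sum_eq_zero]
    intro b _
    rw [emb, Matrix.of_apply, if_neg, zero_mul]
    rintro rfl
    simp at hi
    omega
  · obtain ⟨b, rfl⟩ : ∃ b : Fin 2, i = Fin.natAdd 5 b := by
      revert i; decide
    have h : ∀ b c : Fin 2, Fin.natAdd 5 b = Fin.natAdd 5 c ↔ b = c := by decide
    simp only [emb, Matrix.of_apply, h, ite_mul, one_mul, zero_mul, Finset.sum_ite_eq,
      Finset.mem_univ, if_true]

theorem P_mul_emb {q : SO7} (hq : q ∈ P) :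
    toMat q * emb = emb * (emb.conjTranspose * toMat q * emb) :=
  mul_emb_of_block fun i j hi hj => P_block hq i j hi hj

/-- Restriction to the invariant plane is multiplicative, so the block of `q⁻¹` is an inverse. -/
theorem P_block_isUnit {q : SO7} (hq : q ∈ P) :
    IsUnit (emb.conjTranspose * toMat q * emb).det := by
  refine Matrix.isUnit_det_of_right_inverse (B := emb.conjTranspose * toMat q⁻¹ * emb) ?_
  calc _ = emb.conjTranspose * toMat q * (emb * (emb.conjTranspose * toMat q⁻¹ * emb)) := by
        simp only [Matrix.mul_assoc]
    _ = emb.conjTranspose * (toMat q * toMat q⁻¹) * emb := by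
        rw [← P_mul_emb (P.inv_mem hq)]
        simp only [Matrix.mul_assoc]
    _ = 1 := by rw [toMat_mul_inv, Matrix.mul_one, emb_gram]

/-- Moving `q` past `X` turns `X` into `Ad q X`, and on the plane `q` acts by a `2 × 2` matrix.
Another representative of `gP` therefore amounts to a change of frame. -/
theorem frame_mul {q : SO7} (hq : q ∈ P) (g : SO7) (X : Mat) :
    frame (g * q) X = frame g (Ad q X) * (emb.conjTranspose * toMat q * emb) := by
  rw [frame, frame, Matrix.mul_assoc _ emb, ← P_mul_emb hq, toMat_mul, Ad]
  calc _ = toMat g * (toMat q * X * (1 : Mat)) * emb := by simp only [Matrix.mul_assoc, mul_one]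
    _ = _ := by rw [← toMat_inv_mul q]; simp only [Matrix.mul_assoc]

theorem Ad_apply_one (q : SO7) : Ad q 1 = 1 := by
  rw [Ad, mul_one, toMat_mul_inv]

theorem Ad_mul_apply (q : SO7) (X Y : Mat) : Ad q (X * Y) = Ad q X * Ad q Y := by
  simp only [Ad]
  calc _ = toMat q * X * 1 * Y * toMat q⁻¹ := by rw [mul_one]; simp only [mul_assoc]
    _ = _ := by rw [← toMat_inv_mul q]; simp only [mul_assoc]

theorem frame_unitary (u g : SO7) (X : Mat) : frame (u * g) X = toMat u * frame g X := by
  simp only [frame, toMat_mul, Matrix.mul_assoc]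

theorem compactForm_gram {u : SO7} (hu : u ∈ compactForm) :
    (toMat u).conjTranspose * toMat u = 1 := Matrix.mem_unitaryGroup_iff'.1 hu

theorem canonicalForm_compact {u : SO7} (hu : u ∈ compactForm) (g : SO7) (X Y : Mat) :
    canonicalForm (u * g) X Y = canonicalForm g X Y := by
  simp only [canonicalForm, frame_unitary, fsForm_unitary (compactForm_gram hu)]

theorem canonicalForm_parabolic {q : SO7} (hq : q ∈ P) (g : SO7) (X Y : Mat) :
    canonicalForm (g * q) X Y = canonicalForm g (Ad q X) (Ad q Y) := by
  simp only [canonicalForm, frame_mul hq, fsForm_mul (P_block_isUnit hq), Ad_apply_one]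

theorem canonicalDeriv_compact {u : SO7} (hu : u ∈ compactForm) (g : SO7) (Z X Y : Mat) :
    canonicalDeriv (u * g) Z X Y = canonicalDeriv g Z X Y := by
  simp only [canonicalDeriv, frame_unitary, fsDeriv_unitary (compactForm_gram hu)]

/-- The second-order term `Z * Y` transforms correctly because `Ad q` is multiplicative on all
matrices. -/
theorem canonicalDeriv_parabolic {q : SO7} (hq : q ∈ P) (g : SO7) (Z X Y : Mat) :
    canonicalDeriv (g * q) Z X Y = canonicalDeriv g (Ad q Z) (Ad q X) (Ad q Y) := by
  simp only [canonicalDeriv, frame_mul hq, fsDeriv_mul (P_block_isUnit hq), Ad_apply_one,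
    Ad_mul_apply]

theorem fsPrim_compact {u : SO7} (hu : u ∈ compactForm) (g : SO7) (Z : Mat) :
    fsPrim (frame (u * g) 1) (frame (u * g) Z) = fsPrim (frame g 1) (frame g Z) := by
  simp only [frame_unitary, fsPrim_unitary (compactForm_gram hu)]

theorem fsPrim_parabolic {q : SO7} (hq : q ∈ P) (g : SO7) (Z : Mat) :
    fsPrim (frame (g * q) 1) (frame (g * q) Z) = fsPrim (frame g 1) (frame g (Ad q Z)) := by
  simp only [frame_mul hq, fsPrim_mul (P_block_isUnit hq), Ad_apply_one]

/-! ### The metric and its derivative at the base point -/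

theorem frame_one (X : Mat) : frame 1 X = X * emb := by
  rw [frame, toMat_one, Matrix.one_mul]

theorem frame_one_one : frame 1 1 = emb := by
  rw [frame_one, Matrix.one_mul]

theorem relGram_emb (B C : Mat2) : relGram emb B C = B.conjTranspose * C := by
  rw [relGram, gramInv, emb_gram, inv_one, Matrix.one_mul]

theorem relGram_emb_apply (X Y : Mat) (a b : Fin 2) :
    relGram emb (Y * emb) (X * emb) a b =
      ∑ i, conj (Y i (Fin.natAdd 5 a)) * X i (Fin.natAdd 5 b) := by
  rw [relGram_emb, Matrix.mul_apply]
  simp only [Matrix.conjTranspose_apply, mul_emb_apply, Complex.star_def]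

theorem relGram_emb_left_apply (X : Mat) (a b : Fin 2) :
    relGram emb emb (X * emb) a b = X (Fin.natAdd 5 a) (Fin.natAdd 5 b) := by
  rw [relGram_emb, conjTranspose_emb_mul_apply, mul_emb_apply]

theorem relGram_emb_right_apply (Y : Mat) (a b : Fin 2) :
    relGram emb (Y * emb) emb a b = conj (Y (Fin.natAdd 5 b) (Fin.natAdd 5 a)) := by
  rw [relGram_emb, mul_emb_apply, Matrix.conjTranspose_apply, mul_emb_apply, Complex.star_def]

/-- The subtracted term of `fsForm` removes the last two rows, leaving the Hermitian product of the
`5 × 2` blocks. The degree-two coordinate occurs there twice, at `(0, 5)` and, negated, at `(1, 6)`;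
hence the weight `deg`. -/
theorem canonicalForm_one {X Y : Mat} (hX : X ∈ so7) (hY : Y ∈ so7) :
    canonicalForm 1 X Y = ∑ a, (deg a : ℂ) * (coord X a * conj (coord Y a)) := by
  obtain ⟨x1, x2, x3⟩ := so7_corner hX
  obtain ⟨y1, y2, y3⟩ := so7_corner hY
  simp only [canonicalForm, fsForm, frame_one, Matrix.one_mul, Matrix.trace, Matrix.diag_apply,
    Matrix.mul_apply (M := relGram _ _ _), relGram_emb_apply, relGram_emb_left_apply,
    relGram_emb_right_apply]
  simp only [Fin.sum_univ_two, Fin.sum_univ_seven,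
    show Fin.natAdd 5 (0 : Fin 2) = (5 : Fin 7) from rfl,
    show Fin.natAdd 5 (1 : Fin 2) = (6 : Fin 7) from rfl,
    show coord X 0 = X 2 5 from rfl, show coord X 1 = X 2 6 from rfl,
    show coord X 2 = X 3 5 from rfl, show coord X 3 = X 3 6 from rfl,
    show coord X 4 = X 4 5 from rfl, show coord X 5 = X 4 6 from rfl,
    show coord X 6 = X 0 5 from rfl,
    show coord Y 0 = Y 2 5 from rfl, show coord Y 1 = Y 2 6 from rfl,
    show coord Y 2 = Y 3 5 from rfl, show coord Y 3 = Y 3 6 from rfl,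
    show coord Y 4 = Y 4 5 from rfl, show coord Y 5 = Y 4 6 from rfl,
    show coord Y 6 = Y 0 5 from rfl,
    show deg 0 = 1 from rfl, show deg 1 = 1 from rfl, show deg 2 = 1 from rfl,
    show deg 3 = 1 from rfl, show deg 4 = 1 from rfl, show deg 5 = 1 from rfl,
    show deg 6 = 2 from rfl, x1, x2, x3, y1, y2, y3, map_neg, map_zero]
  push_cast
  ring

theorem mul_emb_of_mem {X : Mat} (hX : X ∈ parabolic) :
    X * emb = emb * (emb.conjTranspose * X * emb) :=
  mul_emb_of_block (mem_parabolic.1 hX).2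

theorem relGram_add_right (A B C D : Mat2) :
    relGram A B (C + D) = relGram A B C + relGram A B D := by
  simp only [relGram, Matrix.mul_add]

theorem relGram_add_left (A B C D : Mat2) :
    relGram A (B + C) D = relGram A B D + relGram A C D := by
  simp only [relGram, Matrix.mul_add, Matrix.conjTranspose_add, Matrix.add_mul]

theorem relGram_smul_right (A B C : Mat2) (c : ℂ) :
    relGram A B (c • C) = c • relGram A B C := by
  simp only [relGram, Matrix.mul_smul]

theorem relGram_smul_left (A B C : Mat2) (c : ℂ) :
    relGram A (c • B) C = conj c • relGram A B C := by
  simp only [relGram, Matrix.mul_smul, Matrix.conjTranspose_smul, Matrix.smul_mul,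
    Complex.star_def]

theorem relGram_mul_right (A B C : Mat2) (y : Matrix (Fin 2) (Fin 2) ℂ) :
    relGram A B (C * y) = relGram A B C * y := by
  simp only [relGram, Matrix.mul_assoc]

theorem relGram_emb_mul_left (B C : Mat2) (y : Matrix (Fin 2) (Fin 2) ℂ) :
    relGram emb (B * y) C = y.conjTranspose * relGram emb B C := by
  simp only [relGram_emb, Matrix.conjTranspose_mul, Matrix.mul_assoc]

theorem relGram_emb_self : relGram emb emb emb = 1 := by
  rw [relGram_emb, emb_gram]

theorem frame_add (g : SO7) (X Y : Mat) : frame g (X + Y) = frame g X + frame g Y := by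
  simp only [frame, Matrix.mul_add, Matrix.add_mul]

theorem frame_smul (g : SO7) (c : ℂ) (X : Mat) : frame g (c • X) = c • frame g X := by
  simp only [frame, Matrix.mul_smul, Matrix.smul_mul]

/-- If `X` or `Y` lies in `𝔭`, its frame is `emb` times a `2 × 2` matrix, and the six terms of
`fsDeriv` cancel in pairs. -/
theorem isTangentForm_canonicalDeriv_one (Z : Mat) : IsTangentForm (canonicalDeriv 1 Z) where
  add_left X _ X₂ _ Y _ := by
    simp only [canonicalDeriv, fsDeriv, frame_add, relGram_add_right, Matrix.mul_add,
      Matrix.trace_add]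
    ring
  smul_left c X _ Y _ := by
    simp only [canonicalDeriv, fsDeriv, frame_smul, relGram_smul_right, Matrix.mul_smul,
      Matrix.trace_smul, smul_eq_mul]
    ring
  add_right X _ Y _ Y₂ _ := by
    simp only [canonicalDeriv, fsDeriv, frame_add, relGram_add_left, Matrix.mul_add,
      Matrix.trace_add, Matrix.add_mul]
    ring
  smul_right c X _ Y _ := by
    simp only [canonicalDeriv, fsDeriv, frame_smul, relGram_smul_left, Matrix.mul_smul,
      Matrix.trace_smul, smul_eq_mul, Matrix.smul_mul]
    ring
  parabolic_left X hX Y _ := by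
    simp only [canonicalDeriv, fsDeriv, frame_one, Matrix.one_mul, mul_emb_of_mem hX,
      relGram_mul_right, relGram_emb_self, one_mul, mul_assoc]
    ring
  parabolic_right X _ Y hY := by
    simp only [canonicalDeriv, fsDeriv, frame_one, Matrix.one_mul, Matrix.mul_assoc Z,
      mul_emb_of_mem hY]
    simp only [← Matrix.mul_assoc Z, relGram_emb_mul_left, relGram_emb_self, mul_one, mul_assoc]
    ring

/-- Only the degree-two root vector has its mirror entry in the last two columns as well. -/
theorem basisVec_mul_emb (a : Fin 7) : basisVec a * emb =
    Matrix.single (row a) (![0, 1, 0, 1, 0, 1, 0] a) 1 -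
      if a = 6 then Matrix.single 1 1 1 else 0 := by
  have h1 : ∀ a i : Fin 7, ∀ c : Fin 2, row a = i ∧ col a = Fin.natAdd 5 c ↔
    row a = i ∧ ![0, 1, 0, 1, 0, 1, 0] a = c := by decide
  have h2 : ∀ a i : Fin 7, ∀ c : Fin 2, (col a).rev = i ∧ (row a).rev = Fin.natAdd 5 c ↔
    a = 6 ∧ 1 = i ∧ 1 = c := by decide
  ext i c
  rw [mul_emb_apply, basisVec, F_apply, Matrix.sub_apply, Matrix.single_apply]
  simp only [h1, h2]
  congr 1
  by_cases h : a = 6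
  · simp [h, Matrix.single_apply]
  · simp [h]

/-- Vectors orthogonal to the plane leave only two of the six terms. -/
theorem canonicalDeriv_one_of_block {Z X : Mat} (hX : emb.conjTranspose * (X * emb) = 0) :
    canonicalDeriv 1 Z X X =
      ((Z * (X * emb)).conjTranspose * (X * emb)).trace -
        ((Z * emb).conjTranspose * emb * ((X * emb).conjTranspose * (X * emb))).trace := by
  have hX' : (X * emb).conjTranspose * emb = 0 := by
    rw [← Matrix.conjTranspose_inj, Matrix.conjTranspose_mul, Matrix.conjTranspose_conjTranspose,
      hX, Matrix.conjTranspose_zero]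
  simp only [canonicalDeriv, fsDeriv, frame_one, Matrix.one_mul, relGram_emb, hX, hX',
    Matrix.mul_zero, Matrix.zero_mul, Matrix.trace_zero, Matrix.mul_assoc Z]
  ring

theorem basisVec_emb_block (a : Fin 7) : emb.conjTranspose * (basisVec a * emb) = 0 := by
  have h : ∀ a : Fin 7, ∀ b c : Fin 2, ¬ (row a = Fin.natAdd 5 b ∧ col a = Fin.natAdd 5 c) ∧
    ¬ ((col a).rev = Fin.natAdd 5 b ∧ (row a).rev = Fin.natAdd 5 c) := by decide
  ext b c
  rw [conjTranspose_emb_mul_apply, mul_emb_apply, basisVec, F_apply, if_neg (h a b c).1,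
    if_neg (h a b c).2]
  simp

/-- For `Z` in `so7` this is the conjugated value of the root of `basisVec a` on the diagonal of
`Z`. The excluded degree-two vector has two matrix positions and yields twice the root value. -/
theorem canonicalDeriv_one_basisVec (Z : Mat) {a : Fin 7} (ha : a ≠ 6) :
    canonicalDeriv 1 Z (basisVec a) (basisVec a) =
      conj (Z (row a) (row a)) - conj (Z (col a) (col a)) := by
  have h : ∀ a : Fin 7, Fin.natAdd 5 (![0, 1, 0, 1, 0, 1, 0] a : Fin 2) = col a := by decide
  rw [canonicalDeriv_one_of_block (basisVec_emb_block a), basisVec_mul_emb, if_neg ha, sub_zero,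
    Matrix.conjTranspose_single, star_one, Matrix.single_mul_single_same, mul_one,
    Matrix.trace_mul_single, Matrix.trace_mul_single, Matrix.conjTranspose_apply,
    Matrix.mul_single_apply_same, mul_emb_apply, Matrix.conjTranspose_apply, mul_emb_apply, h]
  simp

theorem canonicalDeriv_one_basisVec_six (Z : Mat) :
    canonicalDeriv 1 Z (basisVec 6) (basisVec 6) =
      conj (Z 0 0) + conj (Z 1 1) - conj (Z 5 5) - conj (Z 6 6) := by
  have hS : basisVec 6 * emb = Matrix.single 0 0 1 - Matrix.single 1 1 1 := by
    rw [basisVec_mul_emb, if_pos rfl]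
    rfl
  have hSS : (basisVec 6 * emb).conjTranspose * (basisVec 6 * emb) = 1 := by
    rw [hS]
    ext a b
    fin_cases a <;> fin_cases b <;>
      simp [Matrix.mul_apply, Matrix.single_apply]
  rw [canonicalDeriv_one_of_block (basisVec_emb_block 6), hSS, Matrix.mul_one, hS,
    Matrix.mul_sub, Matrix.trace_sub, Matrix.trace_mul_single, Matrix.trace_mul_single,
    Matrix.conjTranspose_apply, Matrix.conjTranspose_apply, Matrix.mul_sub, Matrix.sub_apply,
    Matrix.sub_apply, Matrix.mul_single_apply_same, Matrix.mul_single_apply_same,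
    Matrix.mul_single_apply_of_ne, Matrix.mul_single_apply_of_ne, Matrix.trace_fin_two,
    mul_emb_apply, mul_emb_apply, Matrix.conjTranspose_apply, Matrix.conjTranspose_apply,
    mul_emb_apply, mul_emb_apply, show Fin.natAdd 5 (0 : Fin 2) = (5 : Fin 7) from rfl,
    show Fin.natAdd 5 (1 : Fin 2) = (6 : Fin 7) from rfl]
  · simp
    ring
  · decide
  · decide

/-- This is where the Einstein constant arises. Dividing by the degree leaves the sum of the seven
roots of `𝔪⁺`. Rows 2, 3, 4 cancel by antisymmetry, columns 5 and 6 each occur three times, and the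
degree-two root adds one more copy: `3 + 1 = 4`. -/
theorem trace_canonicalDeriv_one {Z : Mat} (hZ : Z ∈ so7) :
    ∑ a, (deg a : ℂ)⁻¹ * canonicalDeriv 1 Z (basisVec a) (basisVec a) =
      -4 * fsPrim (frame 1 1) (frame 1 Z) := by
  have z0 : Z 0 0 = - Z 6 6 := hZ 0 0
  have z1 : Z 1 1 = - Z 5 5 := hZ 1 1
  have z2 : Z 2 2 = - Z 4 4 := hZ 2 2
  have z3 : Z 3 3 = - Z 3 3 := hZ 3 3
  have z3' : conj (Z 3 3) = 0 := by
    rw [show Z 3 3 = 0 by linear_combination z3 / 2, map_zero]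
  rw [Fin.sum_univ_seven, canonicalDeriv_one_basisVec_six]
  simp only [canonicalDeriv_one_basisVec Z (show (0 : Fin 7) ≠ 6 by decide),
    canonicalDeriv_one_basisVec Z (show (1 : Fin 7) ≠ 6 by decide),
    canonicalDeriv_one_basisVec Z (show (2 : Fin 7) ≠ 6 by decide),
    canonicalDeriv_one_basisVec Z (show (3 : Fin 7) ≠ 6 by decide),
    canonicalDeriv_one_basisVec Z (show (4 : Fin 7) ≠ 6 by decide),
    canonicalDeriv_one_basisVec Z (show (5 : Fin 7) ≠ 6 by decide),
    show row 0 = 2 from rfl, show row 1 = 2 from rfl, show row 2 = 3 from rfl,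
    show row 3 = 3 from rfl, show row 4 = 4 from rfl, show row 5 = 4 from rfl,
    show col 0 = 5 from rfl, show col 1 = 6 from rfl, show col 2 = 5 from rfl,
    show col 3 = 6 from rfl, show col 4 = 5 from rfl, show col 5 = 6 from rfl,
    show deg 0 = 1 from rfl, show deg 1 = 1 from rfl, show deg 2 = 1 from rfl,
    show deg 3 = 1 from rfl, show deg 4 = 1 from rfl, show deg 5 = 1 from rfl,
    show deg 6 = 2 from rfl, z0, z1, z2, z3', map_neg]
  rw [fsPrim, frame_one_one, frame_one, Matrix.trace_fin_two, relGram_emb_right_apply,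
    relGram_emb_right_apply, show Fin.natAdd 5 (0 : Fin 2) = (5 : Fin 7) from rfl,
    show Fin.natAdd 5 (1 : Fin 2) = (6 : Fin 7) from rfl]
  push_cast
  ring

/-! ### The metric and its derivative at an arbitrary point -/

/-- Together with the decomposition `g = u q`, this reduces symmetry, positivity and descent to
`𝔤/𝔭` to the base point. -/
theorem canonicalForm_eq {u q : SO7} (hu : u ∈ compactForm) (hq : q ∈ P) {X Y : Mat}
    (hX : X ∈ so7) (hY : Y ∈ so7) :
    canonicalForm (u * q) X Y =
      ∑ a, (deg a : ℂ) * (coord (Ad q X) a * conj (coord (Ad q Y) a)) := by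
  rw [canonicalForm_compact hu, ← one_mul q, canonicalForm_parabolic hq, one_mul,
    canonicalForm_one (Ad_mem_so7 q hX) (Ad_mem_so7 q hY)]

theorem canonicalForm_conj_symm (g : SO7) {X Y : Mat} (hX : X ∈ so7) (hY : Y ∈ so7) :
    canonicalForm g Y X = conj (canonicalForm g X Y) := by
  obtain ⟨u, hu, q, hq, rfl⟩ := exists_compact_mul_parabolic g
  rw [canonicalForm_eq hu hq hX hY, canonicalForm_eq hu hq hY hX, map_sum]
  refine Finset.sum_congr rfl fun a _ => ?_
  simp only [map_mul, Complex.conj_conj, map_intCast]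
  ring

theorem isTangentForm_canonicalForm (g : SO7) : IsTangentForm (canonicalForm g) := by
  have hl : ∀ X ∈ parabolic, ∀ Y ∈ so7, canonicalForm g X Y = 0 := by
    intro X hX Y hY
    obtain ⟨u, hu, q, hq, rfl⟩ := exists_compact_mul_parabolic g
    rw [canonicalForm_eq hu hq (parabolic_le hX) hY]
    refine Finset.sum_eq_zero fun a _ => ?_
    rw [coord_eq_zero ((hq X).2 hX), zero_mul, mul_zero]
  refine ⟨?_, ?_, ?_, ?_, hl, ?_⟩
  · intro X _ X₂ _ Y _
    simp only [canonicalForm, fsForm, frame_add, relGram_add_right, Matrix.mul_add,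
      Matrix.trace_add]
    ring
  · intro c X _ Y _
    simp only [canonicalForm, fsForm, frame_smul, relGram_smul_right, Matrix.mul_smul,
      Matrix.trace_smul, smul_eq_mul]
    ring
  · intro X _ Y _ Y₂ _
    simp only [canonicalForm, fsForm, frame_add, relGram_add_left, Matrix.add_mul,
      Matrix.trace_add]
    ring
  · intro c X _ Y _
    simp only [canonicalForm, fsForm, frame_smul, relGram_smul_left, Matrix.smul_mul,
      Matrix.trace_smul, smul_eq_mul]
    ring
  · intro X hX Y hY
    rw [canonicalForm_conj_symm g (parabolic_le hY) hX, hl Y hY X hX, map_zero]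

theorem deg_pos (a : Fin 7) : 0 < deg a := by
  revert a; decide

theorem canonicalForm_pos (g : SO7) {X : Mat} (hX : X ∈ so7) (hX' : X ∉ parabolic) :
    0 < (canonicalForm g X X).re := by
  obtain ⟨u, hu, q, hq, rfl⟩ := exists_compact_mul_parabolic g
  rw [canonicalForm_eq hu hq hX hX, Complex.re_sum]
  have hterm : ∀ a, ((deg a : ℂ) * (coord (Ad q X) a * conj (coord (Ad q X) a))).re =
      deg a * Complex.normSq (coord (Ad q X) a) := by
    intro a
    rw [Complex.mul_conj, ← Complex.ofReal_intCast, ← Complex.ofReal_mul, Complex.ofReal_re]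
  simp only [hterm]
  have hdeg : ∀ a, (0 : ℝ) < deg a := fun a => Int.cast_pos.2 (deg_pos a)
  refine Finset.sum_pos' (fun a _ => mul_nonneg (hdeg a).le (Complex.normSq_nonneg _)) ?_
  by_contra hne
  push Not at hne
  refine hX' ((hq X).1 (mem_parabolic_of_coord (Ad_mem_so7 q hX) fun a => ?_))
  have h1 := hne a (Finset.mem_univ a)
  have h2 : Complex.normSq (coord (Ad q X) a) ≤ 0 := by
    by_contra h3
    exact absurd (mul_pos (hdeg a) (not_le.1 h3)) (not_lt.2 h1)
  exact Complex.normSq_eq_zero.1 (le_antisymm h2 (Complex.normSq_nonneg _))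

theorem formMatrix_one :
    formMatrix (canonicalForm 1) = Matrix.diagonal fun a => (deg a : ℂ) := by
  ext a b
  rw [formMatrix, Matrix.of_apply, canonicalForm_one (basisVec_mem a) (basisVec_mem b)]
  simp only [coord_basisVec, Matrix.diagonal_apply]
  by_cases hab : a = b
  · subst hab; simp
  · rw [if_neg hab, Finset.sum_eq_zero]
    intro c _
    by_cases h : a = c
    · rw [if_neg (fun e : b = c => hab (h.trans e.symm)), map_zero, mul_zero, mul_zero]
    · rw [if_neg h, zero_mul, mul_zero]

theorem formMatrix_canonicalForm {u q : SO7} (hu : u ∈ compactForm) (hq : q ∈ P) :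
    formMatrix (canonicalForm (u * q)) =
      adMatrix q * formMatrix (canonicalForm 1) * (adMatrix q).conjTranspose := by
  have h := (isTangentForm_canonicalForm 1).gram_eq (v := fun a => Ad q (basisVec a))
    (w := fun a => Ad q (basisVec a)) (fun a => Ad_mem_so7 q (basisVec_mem a))
    (fun a => Ad_mem_so7 q (basisVec_mem a))
  rw [adMatrix, ← h]
  ext a b
  rw [formMatrix, Matrix.of_apply, Matrix.of_apply, canonicalForm_compact hu, ← one_mul q,
    canonicalForm_parabolic hq, one_mul]

/-- The derivative undergoes the same congruence as the metric. Here it matters that the derivative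
at the base point depends only on classes modulo `𝔭`. -/
theorem formMatrix_canonicalDeriv {u q : SO7} (hu : u ∈ compactForm) (hq : q ∈ P) (Z : Mat) :
    formMatrix (canonicalDeriv (u * q) Z) =
      adMatrix q * formMatrix (canonicalDeriv 1 (Ad q Z)) * (adMatrix q).conjTranspose := by
  have h := (isTangentForm_canonicalDeriv_one (Ad q Z)).gram_eq
    (v := fun a => Ad q (basisVec a))
    (w := fun a => Ad q (basisVec a)) (fun a => Ad_mem_so7 q (basisVec_mem a))
    (fun a => Ad_mem_so7 q (basisVec_mem a))
  rw [adMatrix, ← h]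
  ext a b
  rw [formMatrix, Matrix.of_apply, Matrix.of_apply, canonicalDeriv_compact hu, ← one_mul q,
    canonicalDeriv_parabolic hq, one_mul]

theorem formMatrix_isUnit (g : SO7) : IsUnit (formMatrix (canonicalForm g)).det := by
  obtain ⟨u, hu, q, hq, rfl⟩ := exists_compact_mul_parabolic g
  rw [formMatrix_canonicalForm hu hq, Matrix.det_mul, Matrix.det_mul, Matrix.det_conjTranspose,
    formMatrix_one, Matrix.det_diagonal]
  refine ((adMatrix_isUnit hq).mul (IsUnit.mk0 _ (Finset.prod_ne_zero_iff.2 fun a _ => ?_))).mul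
    (adMatrix_isUnit hq).star
  exact Int.cast_ne_zero.2 (deg_pos a).ne'

/-- The metric trace of the antiholomorphic derivative of the metric. -/
theorem trace_canonicalDeriv (g : SO7) {Z : Mat} (hZ : Z ∈ so7) :
    ((formMatrix (canonicalForm g))⁻¹ * formMatrix (canonicalDeriv g Z)).trace =
      -4 * fsPrim (frame g 1) (frame g Z) := by
  obtain ⟨u, hu, q, hq, rfl⟩ := exists_compact_mul_parabolic g
  rw [fsPrim_compact hu, ← one_mul q, fsPrim_parabolic hq, one_mul,
    ← trace_canonicalDeriv_one (Ad_mem_so7 q hZ), formMatrix_canonicalForm hu hq,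
    formMatrix_canonicalDeriv hu hq]
  -- The common congruence by `R` cancels inside the trace.
  set R := adMatrix q
  have hR : IsUnit R.det := adMatrix_isUnit hq
  have hRH : IsUnit R.conjTranspose.det := by
    rw [Matrix.det_conjTranspose]; exact hR.star
  rw [Matrix.mul_inv_rev, Matrix.mul_inv_rev]
  set S := formMatrix (canonicalForm 1) with hS
  set D := formMatrix (canonicalDeriv 1 (Ad q Z)) with hD
  have h1 : R.conjTranspose⁻¹ * (S⁻¹ * R⁻¹) * (R * D * R.conjTranspose) =
      R.conjTranspose⁻¹ * (S⁻¹ * D) * R.conjTranspose := by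
    calc _ = R.conjTranspose⁻¹ * (S⁻¹ * (R⁻¹ * R) * D) * R.conjTranspose := by
          simp only [mul_assoc]
      _ = _ := by rw [Matrix.nonsing_inv_mul _ hR, mul_one]
  have hSinv : S⁻¹ = Matrix.diagonal fun a => (deg a : ℂ)⁻¹ := by
    rw [hS, formMatrix_one]
    refine Matrix.inv_eq_left_inv ?_
    rw [Matrix.diagonal_mul_diagonal, ← Matrix.diagonal_one]
    congr 1
    ext a
    exact inv_mul_cancel₀ (Int.cast_ne_zero.2 (deg_pos a).ne')
  rw [h1, Matrix.trace_mul_comm, ← mul_assoc, Matrix.mul_nonsing_inv _ hRH, one_mul, hSinv,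
    Matrix.trace]
  refine Finset.sum_congr rfl fun a _ => ?_
  rw [Matrix.diag_apply, Matrix.diagonal_mul, hD, formMatrix, Matrix.of_apply]

/-! ### The canonical metric at the base point, and uniqueness -/

/-- The difference lies in `𝔭` but has only entries of positive degree, so it vanishes. -/
theorem mPlus_eq_sum {k : ℤ} (hk : 0 < k) {X : Mat} (hX : X ∈ mPlus k) :
    X = ∑ a, coord X a • basisVec a := by
  have hX7 := (mPlus_grade hX).1
  set Z := X - ∑ a, coord X a • basisVec a with hZ
  have hp : Z ∈ parabolic := sub_sum_mem_parabolic hX7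
  have hgrade : ∀ i j, Z i j ≠ 0 → 0 < wt 1 i - wt 1 j := by
    intro i j hij
    by_contra hn
    apply hij
    have h1 : X i j = 0 := by
      by_contra h
      rw [(mPlus_grade hX).2 i j h] at hn
      exact hn hk
    rw [hZ, Matrix.sub_apply, h1, Matrix.sum_apply, Finset.sum_eq_zero, sub_zero]
    intro a _
    by_contra h
    rw [Matrix.smul_apply, smul_eq_mul] at h
    rw [(mPlus_grade (basisVec_mem_mPlus a)).2 i j (right_ne_zero_of_mul h)] at hn
    exact hn (deg_pos a)
  have hZ0 : Z = 0 := by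
    ext i j
    by_contra h
    have grade : ∀ i j : Fin 7, 0 < wt 1 i - wt 1 j →
        (i.val ≤ 4 ∧ 5 ≤ j.val) ∨ (j.rev.val ≤ 4 ∧ 5 ≤ i.rev.val) := by decide
    obtain ⟨hp1, hp2⟩ := mem_parabolic.1 hp
    rcases grade i j (hgrade i j h) with ⟨a, b⟩ | ⟨a, b⟩
    · exact h (hp2 _ _ a b)
    · exact h (by rw [hp1 i j, hp2 _ _ a b, neg_zero]; rfl)
  exact sub_eq_zero.1 hZ0

theorem coord_mPlus {k : ℤ} {X : Mat} (hX : X ∈ mPlus k) {a : Fin 7} (ha : deg a ≠ k) :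
    coord X a = 0 := by
  by_contra h
  have hd : ∀ a, deg a = wt 1 (row a) - wt 1 (col a) := by decide
  exact ha ((hd a).trans ((mPlus_grade hX).2 _ _ h))

/-- The conjugation sends `F i j` to `- F j i`, so with this normalization the root vectors are
orthonormal for `-K(X, Ȳ)`. -/
theorem killing_basisVec (a b : Fin 7) :
    killing (basisVec a) (cconj (basisVec b)) = if a = b then -1 else 0 := by
  have h : cconj (basisVec b) = - F (col b) (row b) := by
    rw [cconj, basisVec, F, F, Matrix.conjTranspose_sub, Matrix.conjTranspose_single,
      Matrix.conjTranspose_single, star_one]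
  have h1 : ∀ a b : Fin 7, (row a = row b ∧ col a = col b) ↔ a = b := by decide
  have h2 : ∀ a b : Fin 7, ¬ (col a = (row b).rev ∧ row a = (col b).rev) := by decide
  have h3 : ∀ A B : Mat, killing A (-B) = - killing A B := by
    intro A B
    simp [killing, neg_div]
  rw [h, h3, basisVec, killing_F]
  simp only [h1, if_neg (h2 a b)]
  split_ifs <;> simp

theorem killing_eq_sum {k l : ℤ} (hk : 0 < k) (hl : 0 < l) {X Y : Mat} (hX : X ∈ mPlus k)
    (hY : Y ∈ mPlus l) :
    killing X (cconj Y) = - ∑ a, coord X a * conj (coord Y a) := by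
  have hY' : cconj Y = ∑ b, conj (coord Y b) • cconj (basisVec b) := by
    conv_lhs => rw [mPlus_eq_sum hl hY]
    simp [cconj, Matrix.conjTranspose_sum]
  rw [hY']
  conv_lhs => rw [mPlus_eq_sum hk hX]
  have h1 : killing (∑ a, coord X a • basisVec a) (∑ b, conj (coord Y b) • cconj (basisVec b)) =
      ∑ a, ∑ b, coord X a * conj (coord Y b) * killing (basisVec a) (cconj (basisVec b)) := by
    simp only [killing, Finset.sum_mul_sum, Matrix.trace_sum, Finset.sum_div, Matrix.smul_mul,
      Matrix.mul_smul, Matrix.trace_smul, smul_eq_mul]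
    refine Finset.sum_congr rfl fun a _ => Finset.sum_congr rfl fun b _ => ?_
    ring
  rw [h1, ← Finset.sum_neg_distrib]
  refine Finset.sum_congr rfl fun a _ => ?_
  simp [killing_basisVec]

theorem canonicalForm_base {k : ℤ} (hk : 0 < k) {X Y : Mat} (hX : X ∈ mPlus k)
    (hY : Y ∈ mPlus k) : canonicalForm 1 X Y = - (k : ℂ) * killing X (cconj Y) := by
  rw [canonicalForm_one (mPlus_grade hX).1 (mPlus_grade hY).1, killing_eq_sum hk hk hX hY,
    neg_mul_neg, Finset.mul_sum]
  refine Finset.sum_congr rfl fun a _ => ?_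
  by_cases h : deg a = k
  · rw [h]
  · rw [coord_mPlus hX h, zero_mul, mul_zero, mul_zero]

theorem canonicalForm_base_ne {k l : ℤ} (hkl : k ≠ l) {X Y : Mat} (hX : X ∈ mPlus k)
    (hY : Y ∈ mPlus l) : canonicalForm 1 X Y = 0 := by
  rw [canonicalForm_one (mPlus_grade hX).1 (mPlus_grade hY).1]
  refine Finset.sum_eq_zero fun a _ => ?_
  by_cases h : deg a = k
  · rw [coord_mPlus hY (fun e => hkl (h.symm.trans e)), map_zero, mul_zero, mul_zero]
  · rw [coord_mPlus hX h, zero_mul, mul_zero]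

theorem IsHermitianMetric.isTangentForm {h : Form} (hh : IsHermitianMetric h) (g : SO7) :
    IsTangentForm (h g) where
  add_left := hh.add_left g
  smul_left := hh.smul_left g
  parabolic_left := hh.parabolic_left g
  add_right X hX Y hY Y₂ hY₂ := by
    rw [hh.conj_symm g _ (so7.add_mem hY hY₂) _ hX, hh.add_left g _ hY _ hY₂ _ hX, map_add,
      ← hh.conj_symm g _ hY _ hX, ← hh.conj_symm g _ hY₂ _ hX]
  smul_right c X hX Y hY := by
    rw [hh.conj_symm g _ (so7.smul_mem c hY) _ hX, hh.smul_left g _ _ hY _ hX, map_mul,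
      ← hh.conj_symm g _ hY _ hX]
  parabolic_right X hX Y hY := by
    rw [hh.conj_symm g _ (parabolic_le hY) _ hX, hh.parabolic_left g _ hY _ hX, map_zero]

/-- Uniqueness: the graded root vectors fix the Gram matrix at the base point, and `G = G_u P`
propagates it. -/
theorem IsCanonicalMetric.eq_canonicalForm {h : Form} (hh : IsCanonicalMetric h) (g : SO7)
    {X Y : Mat} (hX : X ∈ so7) (hY : Y ∈ so7) : h g X Y = canonicalForm g X Y := by
  obtain ⟨u, hu, q, hq, rfl⟩ := exists_compact_mul_parabolic g
  have hm : formMatrix (h 1) = formMatrix (canonicalForm 1) := by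
    ext a b
    have ha := basisVec_mem_mPlus a
    have hb := basisVec_mem_mPlus b
    rw [formMatrix, formMatrix, Matrix.of_apply, Matrix.of_apply]
    by_cases hab : deg a = deg b
    · rw [← hab] at hb
      rw [hh.base _ (deg_pos a) _ ha _ hb, canonicalForm_base (deg_pos a) ha hb]
    · rw [hh.base_ne _ (deg_pos a) _ (deg_pos b) hab _ ha _ hb, canonicalForm_base_ne hab ha hb]
  rw [hh.homogeneous u hu _ _ hX _ hY, canonicalForm_compact hu, ← one_mul q,
    hh.equivariant 1 q hq _ hX _ hY, canonicalForm_parabolic hq,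
    (hh.isTangentForm 1).eq_sum (Ad_mem_so7 q hX) (Ad_mem_so7 q hY),
    (isTangentForm_canonicalForm 1).eq_sum (Ad_mem_so7 q hX) (Ad_mem_so7 q hY), hm]

section WirtingerCalculus

/-! ### Wirtinger derivatives -/

/-- The common form of the two Wirtinger derivatives. -/
def wd (c : ℂ) (i : Fin 7) (f : (Fin 7 → ℂ) → ℂ) (x : Fin 7 → ℂ) : ℂ :=
  (fderiv ℝ f x (Pi.single i 1) + c * fderiv ℝ f x (Pi.single i Complex.I)) / 2

theorem dz_eq_wd (i : Fin 7) : dz i = wd (-Complex.I) i := by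
  funext f x
  rw [dz, wd]
  ring

theorem dzbar_eq_wd (i : Fin 7) : dzbar i = wd Complex.I i := rfl

variable {c : ℂ} {i j : Fin 7} {f g : (Fin 7 → ℂ) → ℂ} {x : Fin 7 → ℂ}

theorem wd_congr (h : f =ᶠ[𝓝 x] g) : wd c i f x = wd c i g x := by
  rw [wd, wd, h.fderiv_eq]

theorem wd_const (a : ℂ) : wd c i (fun _ => a) x = 0 := by
  simp [wd]

theorem wd_add (hf : DifferentiableAt ℝ f x) (hg : DifferentiableAt ℝ g x) :
    wd c i (fun y => f y + g y) x = wd c i f x + wd c i g x := by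
  simp only [wd, fderiv_fun_add hf hg, add_apply]
  ring

theorem wd_sub (hf : DifferentiableAt ℝ f x) (hg : DifferentiableAt ℝ g x) :
    wd c i (fun y => f y - g y) x = wd c i f x - wd c i g x := by
  simp only [wd, fderiv_fun_sub hf hg, sub_apply]
  ring

theorem wd_mul (hf : DifferentiableAt ℝ f x) (hg : DifferentiableAt ℝ g x) :
    wd c i (fun y => f y * g y) x = wd c i f x * g x + f x * wd c i g x := by
  simp only [wd, fderiv_fun_mul hf hg, add_apply,
    smul_apply, smul_eq_mul]
  ring

theorem wd_const_mul (a : ℂ) (hf : DifferentiableAt ℝ f x) :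
    wd c i (fun y => a * f y) x = a * wd c i f x := by
  rw [wd_mul (differentiableAt_const a) hf, wd_const, zero_mul, zero_add]

theorem wd_sum {ι : Type*} (s : Finset ι) {F : ι → (Fin 7 → ℂ) → ℂ}
    (hF : ∀ k ∈ s, DifferentiableAt ℝ (F k) x) :
    wd c i (fun y => ∑ k ∈ s, F k y) x = ∑ k ∈ s, wd c i (F k) x := by
  simp only [wd, fderiv_fun_sum hF, sum_apply, Finset.mul_sum,
    ← Finset.sum_add_distrib, Finset.sum_div]

theorem wd_conj (hf : DifferentiableAt ℝ f x) :
    wd c i (fun y => conj (f y)) x = conj (wd (conj c) i f x) := by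
  have h : HasFDerivAt (fun y => conj (f y))
      ((Complex.conjCLE : ℂ →L[ℝ] ℂ).comp (fderiv ℝ f x)) x :=
    (Complex.conjCLE : ℂ →L[ℝ] ℂ).hasFDerivAt.comp x hf.hasFDerivAt
  simp only [wd, h.fderiv, ContinuousLinearMap.comp_apply, ContinuousLinearEquiv.coe_coe,
    Complex.conjCLE_apply, map_div₀, map_add, map_mul, Complex.conj_conj, map_ofNat]

theorem single_I (i : Fin 7) :
    (Pi.single i Complex.I : Fin 7 → ℂ) = Complex.I • Pi.single i 1 := by
  rw [← Pi.single_smul', smul_eq_mul, mul_one]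

/-- Complex linearity of the derivative produces the scalar: it is 0 for `c = I` and 1 for `c = -I`.
-/
theorem wd_of_holomorphic (hf : DifferentiableAt ℂ f x) :
    wd c i f x = (1 + c * Complex.I) / 2 * fderiv ℂ f x (Pi.single i 1) := by
  rw [wd, (hf.hasFDerivAt.restrictScalars ℝ).fderiv, ContinuousLinearMap.coe_restrictScalars',
    single_I, map_smul, smul_eq_mul]
  ring

theorem dzbar_of_holomorphic (hf : DifferentiableAt ℂ f x) : dzbar i f x = 0 := by
  rw [dzbar_eq_wd, wd_of_holomorphic hf, Complex.I_mul_I]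
  simp

theorem dz_of_holomorphic (hf : DifferentiableAt ℂ f x) :
    dz i f x = fderiv ℂ f x (Pi.single i 1) := by
  rw [dz_eq_wd, wd_of_holomorphic hf, neg_mul, Complex.I_mul_I]
  norm_num

theorem wd_contDiffAt (hf : ContDiffAt ℝ ∞ f x) : ContDiffAt ℝ ∞ (wd c i f) x := by
  have h : ContDiffAt ℝ ∞ (fderiv ℝ f) x := hf.fderiv_right (by norm_num)
  unfold wd
  exact ((h.clm_apply contDiffAt_const).add
    (contDiffAt_const.mul (h.clm_apply contDiffAt_const))).div_const 2

theorem fderiv_fderiv_apply (hf : ContDiffAt ℝ ∞ f x) (v w : Fin 7 → ℂ) :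
    fderiv ℝ (fun y => fderiv ℝ f y v) x w = fderiv ℝ (fun y => fderiv ℝ f y w) x v := by
  have h : ContDiffAt ℝ ∞ (fderiv ℝ f) x := hf.fderiv_right (by norm_num)
  have h' : DifferentiableAt ℝ (fderiv ℝ f) x := h.differentiableAt (by norm_num)
  have hs : IsSymmSndFDerivAt ℝ f x := hf.isSymmSndFDerivAt (by
    rw [minSmoothness_of_isRCLikeNormedField]; exact ENat.LEInfty.out)
  rw [fderiv_clm_apply h' (differentiableAt_const _), fderiv_clm_apply h'
    (differentiableAt_const _)]
  simp only [fderiv_fun_const, Pi.zero_apply, ContinuousLinearMap.comp_zero, zero_add,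
    ContinuousLinearMap.flip_apply]
  exact hs w v

/-- Symmetry of the real second derivative, extended linearly; the Kähler condition rests on it. -/
theorem wd_comm (hf : ContDiffAt ℝ ∞ f x) (c d : ℂ) (i j : Fin 7) :
    wd c i (wd d j f) x = wd d j (wd c i f) x := by
  have h : ContDiffAt ℝ ∞ (fderiv ℝ f) x := hf.fderiv_right (by norm_num)
  have hd : ∀ v, DifferentiableAt ℝ (fun y => fderiv ℝ f y v) x := fun v =>
    (h.clm_apply contDiffAt_const).differentiableAt (by norm_num)
  have key : ∀ (d : ℂ) (j : Fin 7) (v : Fin 7 → ℂ), fderiv ℝ (wd d j f) x v =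
      (fderiv ℝ (fun y => fderiv ℝ f y (Pi.single j 1)) x v +
        d * fderiv ℝ (fun y => fderiv ℝ f y (Pi.single j Complex.I)) x v) / 2 := by
    intro d j v
    have e : HasFDerivAt (wd d j f)
        ((2 : ℂ)⁻¹ • (fderiv ℝ (fun y => fderiv ℝ f y (Pi.single j 1)) x +
          d • fderiv ℝ (fun y => fderiv ℝ f y (Pi.single j Complex.I)) x)) x := by
      have := (((hd (Pi.single j 1)).hasFDerivAt.add
        ((hd (Pi.single j Complex.I)).hasFDerivAt.const_mul d)).const_mul (2 : ℂ)⁻¹)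
      refine this.congr_of_eventuallyEq (Eventually.of_forall fun y => ?_)
      simp only [wd, Pi.add_apply]
      ring
    rw [e.fderiv]
    simp only [smul_apply, add_apply, smul_eq_mul]
    ring
  rw [wd, wd, key, key, key, key]
  rw [fderiv_fderiv_apply hf (Pi.single j 1) (Pi.single i 1),
    fderiv_fderiv_apply hf (Pi.single j 1) (Pi.single i Complex.I),
    fderiv_fderiv_apply hf (Pi.single j Complex.I) (Pi.single i 1),
    fderiv_fderiv_apply hf (Pi.single j Complex.I) (Pi.single i Complex.I)]
  ring

/-- The real derivative in terms of the Wirtinger derivatives. -/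
theorem fderiv_eq_sum_wirtinger (f : (Fin 7 → ℂ) → ℂ) (x u : Fin 7 → ℂ) :
    fderiv ℝ f x u = ∑ k, (u k * dz k f x + conj (u k) * dzbar k f x) := by
  have hu : u = ∑ k, ((u k).re • (Pi.single k 1 : Fin 7 → ℂ) +
      (u k).im • (Pi.single k Complex.I : Fin 7 → ℂ)) := by
    ext l
    rw [Finset.sum_apply, Finset.sum_eq_single l]
    · simp [Complex.re_add_im]
    · intro k _ hk
      simp [Pi.single_eq_of_ne hk.symm]
    · simp
  conv_lhs => rw [hu]
  rw [map_sum]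
  refine Finset.sum_congr rfl fun k _ => ?_
  rw [map_add, map_smul, map_smul, dz, dzbar, Complex.real_smul, Complex.real_smul]
  conv_rhs => rw [← Complex.re_add_im (u k)]
  simp only [map_add, map_mul, Complex.conj_ofReal, Complex.conj_I]
  linear_combination ((u k).im : ℂ) * fderiv ℝ f x (Pi.single k Complex.I) * Complex.I_mul_I

/-! ### Matrix valued functions -/

/-- Entrywise smoothness over `𝕜`. -/
def SmoothAt (𝕜 : Type*) [NontriviallyNormedField 𝕜] [NormedAlgebra 𝕜 ℂ] {m n : Type*}
    (M : (Fin 7 → ℂ) → Matrix m n ℂ) (x : Fin 7 → ℂ) : Prop :=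
  ∀ a b, ContDiffAt 𝕜 ∞ (fun y => M y a b) x

/-- Entrywise Wirtinger derivatives. -/
def wdM {m n : Type*} (c : ℂ) (i : Fin 7) (M : (Fin 7 → ℂ) → Matrix m n ℂ) (x : Fin 7 → ℂ) :
    Matrix m n ℂ := Matrix.of fun a b => wd c i (fun y => M y a b) x

section MatrixCalculus

variable {𝕜 : Type*} [NontriviallyNormedField 𝕜] [NormedAlgebra 𝕜 ℂ]
variable {l m n : Type*} [Fintype m]
variable {M : (Fin 7 → ℂ) → Matrix l m ℂ} {N : (Fin 7 → ℂ) → Matrix m n ℂ}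

theorem SmoothAt.mul (hM : SmoothAt 𝕜 M x) (hN : SmoothAt 𝕜 N x) :
    SmoothAt 𝕜 (fun y => M y * N y) x := by
  intro a b
  simp only [Matrix.mul_apply]
  exact ContDiffAt.sum fun k _ => (hM a k).mul (hN k b)

theorem SmoothAt.const {l m : Type*} (A : Matrix l m ℂ) : SmoothAt 𝕜 (fun _ => A) x :=
  fun _ _ => contDiffAt_const

theorem SmoothAt.conjTranspose {l m : Type*} {M : (Fin 7 → ℂ) → Matrix l m ℂ} (hM : SmoothAt ℝ M x) :
    SmoothAt ℝ (fun y => (M y).conjTranspose) x := by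
  intro a b
  exact (Complex.conjCLE : ℂ →L[ℝ] ℂ).contDiff.contDiffAt.comp x (hM b a)

theorem SmoothAt.trace {M : (Fin 7 → ℂ) → Matrix m m ℂ} (hM : SmoothAt 𝕜 M x) :
    ContDiffAt 𝕜 ∞ (fun y => (M y).trace) x := by
  simp only [Matrix.trace]
  exact ContDiffAt.sum fun k _ => hM k k

theorem SmoothAt.det [DecidableEq m] {M : (Fin 7 → ℂ) → Matrix m m ℂ} (hM : SmoothAt 𝕜 M x) :
    ContDiffAt 𝕜 ∞ (fun y => (M y).det) x := by
  simp only [Matrix.det_apply']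
  exact ContDiffAt.sum fun σ _ => contDiffAt_const.mul (contDiffAt_prod fun k _ => hM _ _)

/-- Cramer's rule: the entries are quotients of determinants. -/
theorem SmoothAt.inv [DecidableEq m] {M : (Fin 7 → ℂ) → Matrix m m ℂ} (hM : SmoothAt 𝕜 M x)
    (hx : IsUnit (M x).det) : SmoothAt 𝕜 (fun y => (M y)⁻¹) x := by
  intro a b
  simp only [Matrix.inv_def, Matrix.smul_apply, smul_eq_mul, Ring.inverse_eq_inv',
    Matrix.adjugate_apply]
  refine (hM.det.inv hx.ne_zero).mul (SmoothAt.det fun c d => ?_)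
  by_cases hc : c = b
  · subst hc
    simp only [Matrix.updateRow_self]
    exact contDiffAt_const
  · simp only [Matrix.updateRow_ne hc]
    exact hM c d

theorem SmoothAt.differentiableAt {l m : Type*} {M : (Fin 7 → ℂ) → Matrix l m ℂ}
    (hM : SmoothAt 𝕜 M x) (a : l) (b : m) : DifferentiableAt 𝕜 (fun y => M y a b) x :=
  (hM a b).differentiableAt (by norm_num)

theorem SmoothAt.restrictScalars {l m : Type*} {M : (Fin 7 → ℂ) → Matrix l m ℂ}
    (hM : SmoothAt ℂ M x) : SmoothAt ℝ M x := fun a b => (hM a b).restrict_scalars ℝ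

theorem SmoothAt.wdM {l m : Type*} {M : (Fin 7 → ℂ) → Matrix l m ℂ} (hM : SmoothAt ℝ M x) :
    SmoothAt ℝ (wdM c i M) x := fun a b => wd_contDiffAt (hM a b)

theorem wdM_congr {l m : Type*} {M N : (Fin 7 → ℂ) → Matrix l m ℂ} (h : M =ᶠ[𝓝 x] N) :
    wdM c i M x = wdM c i N x := by
  ext a b
  exact wd_congr (h.mono fun y hy => by simp only [hy])

theorem wdM_const {l m : Type*} (A : Matrix l m ℂ) : wdM c i (fun _ => A) x = 0 := by
  ext a b
  exact wd_const _

theorem wdM_mul (hM : SmoothAt ℝ M x) (hN : SmoothAt ℝ N x) :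
    wdM c i (fun y => M y * N y) x = wdM c i M x * N x + M x * wdM c i N x := by
  ext a b
  simp only [wdM, Matrix.of_apply, Matrix.mul_apply, Matrix.add_apply]
  have h := wd_sum (c := c) (i := i) Finset.univ (F := fun k y => M y a k * N y k b)
    fun k _ => (hM.differentiableAt a k).mul (hN.differentiableAt k b)
  rw [h, ← Finset.sum_add_distrib]
  exact Finset.sum_congr rfl fun k _ =>
    wd_mul (hM.differentiableAt a k) (hN.differentiableAt k b)

theorem wd_trace {M : (Fin 7 → ℂ) → Matrix m m ℂ} (hM : SmoothAt ℝ M x) :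
    wd c i (fun y => (M y).trace) x = (wdM c i M x).trace := by
  simp only [Matrix.trace, Matrix.diag_apply]
  exact wd_sum _ fun k _ => hM.differentiableAt k k

theorem wdM_conjTranspose {l m : Type*} {M : (Fin 7 → ℂ) → Matrix l m ℂ}
    (hM : SmoothAt ℝ M x) :
    wdM c i (fun y => (M y).conjTranspose) x = (wdM (conj c) i M x).conjTranspose := by
  ext a b
  exact wd_conj (hM.differentiableAt b a)

theorem wdM_transpose {l m : Type*} {M : (Fin 7 → ℂ) → Matrix l m ℂ} :
    wdM c i (fun y => (M y).transpose) x = (wdM c i M x).transpose := rfl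

theorem wdM_inv [DecidableEq m] {M : (Fin 7 → ℂ) → Matrix m m ℂ} (hM : SmoothAt ℝ M x)
    (hx : ∀ᶠ y in 𝓝 x, IsUnit (M y).det) :
    wdM c i (fun y => (M y)⁻¹) x = - ((M x)⁻¹ * wdM c i M x * (M x)⁻¹) := by
  have hx0 := hx.self_of_nhds
  have h1 := wdM_mul (c := c) (i := i) (hM.inv hx0) hM
  have h2 : (fun y => (M y)⁻¹ * M y) =ᶠ[𝓝 x] fun _ => 1 :=
    hx.mono fun y hy => Matrix.nonsing_inv_mul _ hy
  rw [wdM_congr h2, wdM_const] at h1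
  have h3 := congrArg (· * (M x)⁻¹) h1
  simp only [zero_mul, add_mul, mul_assoc, Matrix.mul_nonsing_inv _ hx0, mul_one] at h3
  rw [eq_neg_of_add_eq_zero_left h3.symm, mul_assoc]

theorem wdM_I_of_holomorphic {l m : Type*} {M : (Fin 7 → ℂ) → Matrix l m ℂ}
    (hM : SmoothAt ℂ M x) : wdM Complex.I i M x = 0 := by
  ext a b
  exact dzbar_of_holomorphic (hM.differentiableAt a b)

end MatrixCalculus

end WirtingerCalculus

/-! ### Wirtinger derivatives of the Fubini–Study form -/

section FubiniStudyCalculus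

variable {i j : Fin 7} {x : Fin 7 → ℂ} {A B C : (Fin 7 → ℂ) → Mat2}

theorem SmoothAt.gramInv (hA : SmoothAt ℝ A x)
    (hx : IsUnit ((A x).conjTranspose * A x).det) : SmoothAt ℝ (fun y => gramInv (A y)) x :=
  (hA.conjTranspose.mul hA).inv hx

theorem SmoothAt.relGram (hA : SmoothAt ℝ A x) (hB : SmoothAt ℝ B x) (hC : SmoothAt ℝ C x)
    (hx : IsUnit ((A x).conjTranspose * A x).det) :
    SmoothAt ℝ (fun y => relGram (A y) (B y) (C y)) x :=
  (hA.gramInv hx).mul (hB.conjTranspose.mul hC)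

theorem fsForm_contDiffAt (hA : SmoothAt ℝ A x) (hB : SmoothAt ℝ B x) (hC : SmoothAt ℝ C x)
    (hx : IsUnit ((A x).conjTranspose * A x).det) :
    ContDiffAt ℝ ∞ (fun y => fsForm (A y) (B y) (C y)) x :=
  (hA.relGram hC hB hx).trace.sub ((hA.relGram hC hA hx).mul (hA.relGram hA hB hx)).trace

theorem conj_neg_I : conj (-Complex.I) = Complex.I := by simp

/-- The antiholomorphic derivative of normalized Gram matrices. -/
theorem wdM_I_relGram (hA : SmoothAt ℂ A x) (hB : SmoothAt ℂ B x) (hC : SmoothAt ℂ C x)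
    (hx : ∀ᶠ y in 𝓝 x, IsUnit ((A y).conjTranspose * A y).det) :
    wdM Complex.I j (fun y => relGram (A y) (B y) (C y)) x =
      relGram (A x) (wdM (-Complex.I) j B x) (C x) -
        relGram (A x) (wdM (-Complex.I) j A x) (A x) * relGram (A x) (B x) (C x) := by
  have hA' := hA.restrictScalars
  have hB' := hB.restrictScalars
  have hC' := hC.restrictScalars
  have h1 := wdM_mul (c := Complex.I) (i := j) (hA'.gramInv hx.self_of_nhds)
    (hB'.conjTranspose.mul hC')
  have h2 : wdM Complex.I j (fun y => gramInv (A y)) x = _ :=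
    wdM_inv (hA'.conjTranspose.mul hA') hx
  -- Since `A` and `C` are holomorphic, `∂̄` acts only through the conjugate transposes.
  rw [wdM_mul hB'.conjTranspose hC', h2, wdM_mul hA'.conjTranspose hA',
    wdM_conjTranspose hA', wdM_conjTranspose hB', wdM_I_of_holomorphic hA,
    wdM_I_of_holomorphic hC, Complex.conj_I, Matrix.mul_zero, Matrix.mul_zero, add_zero,
    add_zero] at h1
  refine h1.trans ?_
  simp only [relGram, gramInv, neg_mul, mul_assoc]
  rw [neg_add_eq_sub]

/-- The holomorphic derivative of normalized Gram matrices. -/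
theorem wdM_neg_I_relGram (hA : SmoothAt ℂ A x) (hB : SmoothAt ℂ B x) (hC : SmoothAt ℂ C x)
    (hx : ∀ᶠ y in 𝓝 x, IsUnit ((A y).conjTranspose * A y).det) :
    wdM (-Complex.I) j (fun y => relGram (A y) (B y) (C y)) x =
      relGram (A x) (B x) (wdM (-Complex.I) j C x) -
        relGram (A x) (A x) (wdM (-Complex.I) j A x) * relGram (A x) (B x) (C x) := by
  have hA' := hA.restrictScalars
  have hB' := hB.restrictScalars
  have hC' := hC.restrictScalars
  have h1 := wdM_mul (c := -Complex.I) (i := j) (hA'.gramInv hx.self_of_nhds)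
    (hB'.conjTranspose.mul hC')
  have h2 : wdM (-Complex.I) j (fun y => gramInv (A y)) x = _ :=
    wdM_inv (hA'.conjTranspose.mul hA') hx
  rw [wdM_mul hB'.conjTranspose hC', h2, wdM_mul hA'.conjTranspose hA',
    wdM_conjTranspose hA', wdM_conjTranspose hB', conj_neg_I, wdM_I_of_holomorphic hA,
    wdM_I_of_holomorphic hB, Matrix.conjTranspose_zero, Matrix.zero_mul, Matrix.zero_mul,
    zero_add, zero_add] at h1
  refine h1.trans ?_
  simp only [relGram, gramInv, neg_mul, mul_assoc]
  rw [neg_add_eq_sub]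

/-- The product rule applied to three normalized Gram matrices, two terms for each, gives the six
terms of `fsDeriv`. -/
theorem dzbar_fsForm (hA : SmoothAt ℂ A x) (hB : SmoothAt ℂ B x) (hC : SmoothAt ℂ C x)
    (hx : ∀ᶠ y in 𝓝 x, IsUnit ((A y).conjTranspose * A y).det) :
    dzbar j (fun y => fsForm (A y) (B y) (C y)) x =
      fsDeriv (A x) (wdM (-Complex.I) j A x) (B x) (C x) (wdM (-Complex.I) j C x) := by
  have hA' := hA.restrictScalars
  have hB' := hB.restrictScalars
  have hC' := hC.restrictScalars
  have h0 := hx.self_of_nhds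
  have s1 := hA'.relGram hC' hB' h0
  have s2 := hA'.relGram hC' hA' h0
  have s3 := hA'.relGram hA' hB' h0
  simp only [fsForm]
  rw [dzbar_eq_wd, wd_sub (s1.trace.differentiableAt (by norm_num))
    ((s2.mul s3).trace.differentiableAt (by norm_num)), wd_trace s1, wd_trace (s2.mul s3),
    wdM_mul s2 s3, wdM_I_relGram hA hC hB hx, wdM_I_relGram hA hC hA hx,
    wdM_I_relGram hA hA hB hx, fsDeriv]
  simp only [Matrix.sub_mul, Matrix.mul_sub, Matrix.trace_sub, Matrix.trace_add, mul_assoc]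
  ring

/-- The identity `∂(∂̄ log det) = ∂∂̄ log det`; `C` enters conjugated, hence is constant for `∂`. -/
theorem dz_fsPrim (hA : SmoothAt ℂ A x) (hC : SmoothAt ℂ C x)
    (hx : ∀ᶠ y in 𝓝 x, IsUnit ((A y).conjTranspose * A y).det) :
    dz i (fun y => fsPrim (A y) (C y)) x =
      fsForm (A x) (wdM (-Complex.I) i A x) (C x) := by
  have h0 := hx.self_of_nhds
  have s1 := hA.restrictScalars.relGram hC.restrictScalars hA.restrictScalars h0
  simp only [fsPrim]
  rw [dz_eq_wd, wd_trace s1, wdM_neg_I_relGram hA hC hA hx, fsForm, Matrix.trace_sub,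
    Matrix.trace_mul_comm (relGram _ _ (wdM _ _ _ _))]

end FubiniStudyCalculus

theorem frame_gram_isUnit (g : SO7) :
    IsUnit ((frame g 1).conjTranspose * frame g 1).det := by
  obtain ⟨u, hu, q, hq, rfl⟩ := exists_compact_mul_parabolic g
  rw [frame_mul hq, mul_gram_right, Ad_apply_one, ← mul_one u, frame_unitary,
    unitary_gram (compactForm_gram hu), frame_one_one, emb_gram, mul_one, Matrix.det_mul,
    Matrix.det_conjTranspose]
  exact (P_block_isUnit hq).star.mul (P_block_isUnit hq)

theorem eventually_frame_gram_isUnit (s : (Fin 7 → ℂ) → SO7) (x : Fin 7 → ℂ) :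
    ∀ᶠ y in 𝓝 x, IsUnit ((frame (s y) 1).conjTranspose * frame (s y) 1).det :=
  Eventually.of_forall fun y => frame_gram_isUnit (s y)

/-! ### The metric in local coordinates -/

/-- The one-form `∂̄ log det (A* A)` in coordinates. -/
def primitive (s : (Fin 7 → ℂ) → SO7) (j : Fin 7) (y : Fin 7 → ℂ) : ℂ :=
  fsPrim (frame (s y) 1) (frame (s y) (coordVec s y j))

namespace IsCoordinates

variable {Ω : Set (Fin 7 → ℂ)} {s : (Fin 7 → ℂ) → SO7} (hs : IsCoordinates Ω s)
  {x : Fin 7 → ℂ} (hx : x ∈ Ω)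
include hs hx

theorem eventually_mem : ∀ᶠ y in 𝓝 x, y ∈ Ω := hs.isOpen.mem_nhds hx

theorem smooth_toMat : SmoothAt ℂ (fun y => toMat (s y)) x := fun a b =>
  (hs.holomorphic a b x hx).contDiffAt

theorem wdM_toMat (i : Fin 7) :
    wdM (-Complex.I) i (fun y => toMat (s y)) x = toMat (s x) * coordVec s x i := by
  rw [coordVec, ← mul_assoc, toMat_mul_inv, one_mul]
  ext a b
  rw [wdM, Matrix.of_apply, ← dz_eq_wd,
    dz_of_holomorphic ((hs.smooth_toMat hx).differentiableAt a b)]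
  rfl

/-- Differentiate the orthogonality relation satisfied by `s`. -/
theorem coordVec_mem (i : Fin 7) : coordVec s x i ∈ so7 := by
  have h0 := (hs.smooth_toMat hx).restrictScalars
  have ht : SmoothAt ℝ (fun y => (toMat (s y)).transpose) x := fun a b => h0 b a
  have hg : SmoothAt ℝ (fun _ => gram) x := SmoothAt.const gram
  have h1 := wdM_mul (c := -Complex.I) (i := i) (ht.mul hg) h0
  rw [wdM_mul ht hg, wdM_const, wdM_transpose, hs.wdM_toMat hx] at h1
  simp only [SO7_gram] at h1
  rw [wdM_const, mul_zero, add_zero, Matrix.transpose_mul] at h1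
  set ξ := coordVec s x i
  have h2 : ξ.transpose * gram + gram * ξ = 0 := by
    calc _ = ξ.transpose * ((toMat (s x)).transpose * gram * toMat (s x)) +
          ((toMat (s x)).transpose * gram * toMat (s x)) * ξ := by rw [SO7_gram]
      _ = 0 := by rw [h1]; simp only [mul_assoc]
  rw [mem_so7_iff, mul_assoc, eq_neg_of_add_eq_zero_left h2, mul_neg, ← mul_assoc,
    gram_mul_gram, one_mul]

/-- Inversion in the orthogonal group only permutes matrix entries, so it preserves holomorphy. -/
theorem smooth_coordVec (i : Fin 7) : SmoothAt ℂ (fun y => coordVec s y i) x := by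
  have h1 : SmoothAt ℂ (fun y => toMat (s y)⁻¹) x := by
    intro a b
    simp only [toMat_inv_apply]
    exact hs.smooth_toMat hx _ _
  refine h1.mul fun a b => ?_
  have h2 : ContDiffAt ℂ ∞ (fderiv ℂ fun y => toMat (s y) a b) x :=
    (hs.smooth_toMat hx a b).fderiv_right (by norm_num)
  exact h2.clm_apply contDiffAt_const

theorem smooth_frame {X : (Fin 7 → ℂ) → Mat} (hX : SmoothAt ℂ X x) :
    SmoothAt ℂ (fun y => frame (s y) (X y)) x :=
  ((hs.smooth_toMat hx).mul hX).mul (SmoothAt.const emb)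

theorem wdM_frame (X : Mat) (i : Fin 7) :
    wdM (-Complex.I) i (fun y => frame (s y) X) x = frame (s x) (coordVec s x i * X) := by
  have h0 := (hs.smooth_toMat hx).restrictScalars
  have hX : SmoothAt ℝ (fun _ : Fin 7 → ℂ => X) x := SmoothAt.const X
  have hE : SmoothAt ℝ (fun _ : Fin 7 → ℂ => emb) x := SmoothAt.const emb
  have h1 := wdM_mul (c := -Complex.I) (i := i) (h0.mul hX) hE
  rw [wdM_mul h0 hX, wdM_const, wdM_const, hs.wdM_toMat hx, mul_zero, add_zero, Matrix.mul_zero,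
    add_zero] at h1
  rw [frame, ← mul_assoc]
  exact h1

theorem coeff_contDiffAt (i j : Fin 7) :
    ContDiffAt ℝ ∞ (fun y => coeff canonicalForm s y i j) x :=
  fsForm_contDiffAt (hs.smooth_frame hx (SmoothAt.const 1)).restrictScalars
    (hs.smooth_frame hx (hs.smooth_coordVec hx i)).restrictScalars
    (hs.smooth_frame hx (hs.smooth_coordVec hx j)).restrictScalars (frame_gram_isUnit _)

theorem smooth_coeff : SmoothAt ℝ (coeff canonicalForm s) x := fun i j =>
  hs.coeff_contDiffAt hx i j

theorem dzbar_canonicalForm (X Y : Mat) (j : Fin 7) :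
    dzbar j (fun y => canonicalForm (s y) X Y) x =
      canonicalDeriv (s x) (coordVec s x j) X Y := by
  have h := dzbar_fsForm (j := j) (hs.smooth_frame hx (SmoothAt.const 1))
    (hs.smooth_frame hx (SmoothAt.const X)) (hs.smooth_frame hx (SmoothAt.const Y))
    (eventually_frame_gram_isUnit s x)
  rw [hs.wdM_frame hx, hs.wdM_frame hx, mul_one] at h
  exact h

theorem primitive_contDiffAt (j : Fin 7) : ContDiffAt ℝ ∞ (primitive s j) x :=
  ((hs.smooth_frame hx (SmoothAt.const 1)).restrictScalars.relGram
    (hs.smooth_frame hx (hs.smooth_coordVec hx j)).restrictScalars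
    (hs.smooth_frame hx (SmoothAt.const 1)).restrictScalars (frame_gram_isUnit _)).trace

/-- The derivative of the frame in direction `i` is the frame of `coordVec s x i`, so the metric
coefficients have a common `∂`-primitive for each `j`. -/
theorem dz_primitive (i j : Fin 7) :
    dz i (primitive s j) x = coeff canonicalForm s x i j := by
  have h := dz_fsPrim (i := i) (hs.smooth_frame hx (SmoothAt.const 1))
    (hs.smooth_frame hx (hs.smooth_coordVec hx j)) (eventually_frame_gram_isUnit s x)
  rw [hs.wdM_frame hx, mul_one] at h
  exact h

/-- The Kähler condition in coordinates. -/
theorem dz_coeff_comm (i j k : Fin 7) :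
    dz k (fun y => coeff canonicalForm s y i j) x =
      dz i (fun y => coeff canonicalForm s y k j) x := by
  have h : ∀ i, (fun y => coeff canonicalForm s y i j) =ᶠ[𝓝 x] dz i (primitive s j) := fun i =>
    (hs.eventually_mem hx).mono fun y hy => (hs.dz_primitive hy i j).symm
  have hp := hs.primitive_contDiffAt hx j
  simp only [dz_eq_wd] at h ⊢
  rw [wd_congr (h i), wd_congr (h k), wd_comm hp]

theorem coeff_conj_symm (i j : Fin 7) :
    coeff canonicalForm s x i j = conj (coeff canonicalForm s x j i) :=
  canonicalForm_conj_symm _ (hs.coordVec_mem hx j) (hs.coordVec_mem hx i)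

theorem dzbar_coeff (i j k : Fin 7) :
    dzbar k (fun y => coeff canonicalForm s y i j) x =
      conj (dz k (fun y => coeff canonicalForm s y j i) x) := by
  have h : (fun y => coeff canonicalForm s y i j) =ᶠ[𝓝 x]
      fun y => conj (coeff canonicalForm s y j i) :=
    (hs.eventually_mem hx).mono fun y hy => hs.coeff_conj_symm hy i j
  rw [dzbar_eq_wd, wd_congr h, wd_conj ((hs.coeff_contDiffAt hx j i).differentiableAt
    (by norm_num)), Complex.conj_I, dz_eq_wd]

end IsCoordinates

/-- The components of the coordinate vectors with respect to `basisVec`. -/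
def coordMatrix (s : (Fin 7 → ℂ) → SO7) (y : Fin 7 → ℂ) : Mat :=
  Matrix.of fun i a => coord (coordVec s y i) a

/-- The matrix of the metric with respect to `basisVec`. -/
def frameMatrix (s : (Fin 7 → ℂ) → SO7) (y : Fin 7 → ℂ) : Mat :=
  formMatrix (canonicalForm (s y))

/-- The trace of the logarithmic derivative of the components of the coordinate vectors. -/
def logDeriv (s : (Fin 7 → ℂ) → SO7) (j : Fin 7) (y : Fin 7 → ℂ) : ℂ :=
  ((coordMatrix s y)⁻¹ * Matrix.of fun i a =>
    fderiv ℂ (fun z => coordMatrix s z i a) y (Pi.single j 1)).trace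

/-! ### The Ricci curvature in local coordinates -/

namespace IsCoordinates

variable {Ω : Set (Fin 7 → ℂ)} {s : (Fin 7 → ℂ) → SO7} (hs : IsCoordinates Ω s)
  {x : Fin 7 → ℂ} (hx : x ∈ Ω)

include hs hx

theorem smooth_coordMatrix : SmoothAt ℂ (coordMatrix s) x :=
  fun i a => hs.smooth_coordVec hx i (row a) (col a)

/-- A linear relation between the rows would put a nontrivial combination of coordinate vectors in
`𝔭`, contrary to immersivity. -/
theorem coordMatrix_isUnit : IsUnit (coordMatrix s x).det := by
  rw [isUnit_iff_ne_zero]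
  intro h
  obtain ⟨v, hv, hv2⟩ := Matrix.exists_vecMul_eq_zero_iff.2 h
  refine hv (hs.immersion x hx v (mem_parabolic_of_coord
    (sum_smul_mem _ v fun i => hs.coordVec_mem hx i) fun a => ?_))
  rw [coord_sum]
  exact congrFun hv2 a

theorem coeff_eq : coeff canonicalForm s x =
    coordMatrix s x * frameMatrix s x * (coordMatrix s x).conjTranspose :=
  (isTangentForm_canonicalForm (s x)).gram_eq (fun i => hs.coordVec_mem hx i)
    fun i => hs.coordVec_mem hx i

theorem coeff_isUnit : IsUnit (coeff canonicalForm s x).det := by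
  rw [hs.coeff_eq hx, Matrix.det_mul, Matrix.det_mul, Matrix.det_conjTranspose]
  exact ((hs.coordMatrix_isUnit hx).mul (formMatrix_isUnit _)).mul
    (hs.coordMatrix_isUnit hx).star

theorem smooth_frameMatrix : SmoothAt ℝ (frameMatrix s) x := fun a b =>
  fsForm_contDiffAt (hs.smooth_frame hx (SmoothAt.const 1)).restrictScalars
    (hs.smooth_frame hx (SmoothAt.const (basisVec a))).restrictScalars
    (hs.smooth_frame hx (SmoothAt.const (basisVec b))).restrictScalars (frame_gram_isUnit _)

theorem wdM_frameMatrix (j : Fin 7) : wdM Complex.I j (frameMatrix s) x =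
    formMatrix (canonicalDeriv (s x) (coordVec s x j)) := by
  ext a b
  exact hs.dzbar_canonicalForm hx (basisVec a) (basisVec b) j

/-- Holomorphy here is what makes the conjugate of `logDeriv` invisible to `∂`. -/
theorem logDeriv_contDiffAt (j : Fin 7) : ContDiffAt ℂ ∞ (logDeriv s j) x := by
  refine SmoothAt.trace (((hs.smooth_coordMatrix hx).inv (hs.coordMatrix_isUnit hx)).mul
    fun i a => ?_)
  have h2 : ContDiffAt ℂ ∞ (fderiv ℂ fun y => coordMatrix s y i a) x :=
    (hs.smooth_coordMatrix hx i a).fderiv_right (by norm_num)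
  exact h2.clm_apply contDiffAt_const

/-- The trace of the logarithmic derivative of the metric. -/
theorem trace_dzbar_coeff (j : Fin 7) :
    ((coeff canonicalForm s x)⁻¹ * wdM Complex.I j (coeff canonicalForm s) x).trace =
      -4 * primitive s j x + conj (logDeriv s j x) := by
  have hc := hs.smooth_coordMatrix hx
  have hc' := hc.restrictScalars
  have hH := hs.smooth_frameMatrix hx
  have he : coeff canonicalForm s =ᶠ[𝓝 x] fun y =>
      coordMatrix s y * frameMatrix s y * (coordMatrix s y).conjTranspose :=
    (hs.eventually_mem hx).mono fun y hy => hs.coeff_eq hy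
  have hd : wdM (-Complex.I) j (coordMatrix s) x = Matrix.of fun i a =>
      fderiv ℂ (fun z => coordMatrix s z i a) x (Pi.single j 1) := by
    ext i a
    rw [wdM, Matrix.of_apply, ← dz_eq_wd, dz_of_holomorphic (hc.differentiableAt i a)]
    rfl
  -- In `h = c H c*` the operator `∂̄` kills `c`. The derivative of `H` gives the invariant trace,
  -- and that of `c*` the conjugated logarithmic derivative.
  rw [wdM_congr he, wdM_mul (hc'.mul hH) hc'.conjTranspose, wdM_mul hc' hH,
    wdM_conjTranspose hc', wdM_I_of_holomorphic hc, Complex.conj_I, hs.wdM_frameMatrix hx,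
    hs.coeff_eq hx, Matrix.zero_mul, zero_add, hd, primitive,
    ← trace_canonicalDeriv (s x) (hs.coordVec_mem hx j), logDeriv]
  have hcu := hs.coordMatrix_isUnit hx
  have hHu : IsUnit (frameMatrix s x).det := formMatrix_isUnit _
  change _ = ((frameMatrix s x)⁻¹ * _).trace + _
  set c := coordMatrix s x
  set H := frameMatrix s x
  set D := formMatrix (canonicalDeriv (s x) (coordVec s x j))
  set c' : Mat := Matrix.of fun i a => fderiv ℂ (fun z => coordMatrix s z i a) x (Pi.single j 1)
  have hcu' : IsUnit c.conjTranspose.det := by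
    rw [Matrix.det_conjTranspose]; exact hcu.star
  rw [Matrix.mul_inv_rev, Matrix.mul_inv_rev, mul_add, Matrix.trace_add]
  congr 1
  · calc _ = (c.conjTranspose⁻¹ * (H⁻¹ * (c⁻¹ * c) * D) * c.conjTranspose).trace := by
          simp only [mul_assoc]
      _ = _ := by
          rw [Matrix.nonsing_inv_mul _ hcu, mul_one, Matrix.trace_mul_comm, ← mul_assoc,
            Matrix.mul_nonsing_inv _ hcu', one_mul]
  · calc _ = (c.conjTranspose⁻¹ * (H⁻¹ * (c⁻¹ * c) * H) * c'.conjTranspose).trace := by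
          simp only [mul_assoc]
      _ = (c'.conjTranspose * (c⁻¹).conjTranspose).trace := by
          rw [Matrix.nonsing_inv_mul _ hcu, mul_one, Matrix.nonsing_inv_mul _ hHu, mul_one,
            Matrix.trace_mul_comm, Matrix.conjTranspose_nonsing_inv]
      _ = _ := by
          rw [← Matrix.conjTranspose_mul, Matrix.trace_conjTranspose, Complex.star_def]

/-- The Ricci curvature is the derivative of the trace of the logarithmic derivative. -/
theorem ricci_eq (i j : Fin 7) : ricci canonicalForm s x i j =
    - dz i (fun y => ((coeff canonicalForm s y)⁻¹ *
      wdM Complex.I j (coeff canonicalForm s) y).trace) x := by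
  have hh := hs.smooth_coeff hx
  have hu := hs.coeff_isUnit hx
  have hev : ∀ᶠ y in 𝓝 x, IsUnit (coeff canonicalForm s y).det :=
    (hs.eventually_mem hx).mono fun y hy => hs.coeff_isUnit hy
  have hw : SmoothAt ℝ (fun y => wdM Complex.I j (coeff canonicalForm s) y) x := hh.wdM
  -- Differentiating `h⁻¹` yields the quadratic part of the curvature and differentiating `∂̄h` the
  -- second-order part; what remains is reordering of sums.
  rw [dz_eq_wd, wd_trace ((hh.inv hu).mul hw), wdM_mul (hh.inv hu) hw, wdM_inv hh hev,
    Matrix.trace_add, neg_mul, Matrix.trace_neg, neg_add, neg_neg]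
  simp only [ricci, curv, mul_add, Finset.sum_add_distrib]
  rw [add_comm]
  congr 1
  · simp only [Matrix.trace, Matrix.diag_apply, Matrix.mul_apply, Finset.mul_sum,
      Finset.sum_mul]
    rw [Finset.sum_comm]
    refine Finset.sum_congr rfl fun l _ => ?_
    rw [Finset.sum_comm]
    refine Finset.sum_congr rfl fun p _ => ?_
    rw [Finset.sum_comm]
    refine Finset.sum_congr rfl fun q _ => Finset.sum_congr rfl fun k _ => ?_
    rw [dz_eq_wd, dzbar_eq_wd, wdM, wdM, Matrix.of_apply, Matrix.of_apply]
    ring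
  · simp only [Matrix.trace, Matrix.diag_apply, Matrix.mul_apply, ← Finset.sum_neg_distrib]
    rw [Finset.sum_comm]
    refine Finset.sum_congr rfl fun l _ => Finset.sum_congr rfl fun k _ => ?_
    rw [mul_neg, dz_eq_wd, dzbar_eq_wd]
    rfl

/-- The canonical metric is Einstein. -/
theorem ricci_canonicalForm (i j : Fin 7) :
    ricci canonicalForm s x i j = 4 * coeff canonicalForm s x i j := by
  have he : (fun y => ((coeff canonicalForm s y)⁻¹ *
      wdM Complex.I j (coeff canonicalForm s) y).trace) =ᶠ[𝓝 x]
      fun y => -4 * primitive s j y + conj (logDeriv s j y) :=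
    (hs.eventually_mem hx).mono fun y hy => hs.trace_dzbar_coeff hy j
  have hp : DifferentiableAt ℝ (primitive s j) x :=
    (hs.primitive_contDiffAt hx j).differentiableAt (by norm_num)
  have hl : DifferentiableAt ℂ (logDeriv s j) x :=
    (hs.logDeriv_contDiffAt hx j).differentiableAt (by norm_num)
  have hlr : DifferentiableAt ℝ (logDeriv s j) x := hl.restrictScalars ℝ
  have hlc : DifferentiableAt ℝ (fun y => conj (logDeriv s j y)) x :=
    (Complex.conjCLE : ℂ →L[ℝ] ℂ).differentiableAt.comp x hlr
  rw [hs.ricci_eq hx, dz_eq_wd, wd_congr he, wd_add (hp.const_mul _) hlc, wd_const_mul _ hp,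
    wd_conj hlr, conj_neg_I, ← dzbar_eq_wd, dzbar_of_holomorphic hl, map_zero, add_zero,
    ← dz_eq_wd, hs.dz_primitive hx]
  ring

end IsCoordinates

/-! ### The canonical metric is Kähler–Einstein -/

theorem isCanonicalMetric_canonicalForm : IsCanonicalMetric canonicalForm where
  add_left g := (isTangentForm_canonicalForm g).add_left
  smul_left g := (isTangentForm_canonicalForm g).smul_left
  conj_symm g _ hX _ hY := canonicalForm_conj_symm g hX hY
  parabolic_left g := (isTangentForm_canonicalForm g).parabolic_left
  pos g _ hX hX' := canonicalForm_pos g hX hX'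
  equivariant g _ hq X _ Y _ := canonicalForm_parabolic hq g X Y
  smooth _ _ hs i j _ hx := (hs.coeff_contDiffAt hx i j).contDiffWithinAt
  homogeneous _ hu g X _ Y _ := canonicalForm_compact hu g X Y
  base _ hk _ hX _ hY := canonicalForm_base hk hX hY
  base_ne _ _ _ _ hkl _ hX _ hY := canonicalForm_base_ne hkl hX hY

/-- The holomorphic derivative of the metric, as a trilinear form. -/
def metricDeriv (s : (Fin 7 → ℂ) → SO7) (x u v w : Fin 7 → ℂ) : ℂ :=
  ∑ k, ∑ i, ∑ j, u k * v i * conj (w j) * dz k (fun y => coeff canonicalForm s y i j) x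

theorem metricDeriv_comm {Ω : Set (Fin 7 → ℂ)} {s : (Fin 7 → ℂ) → SO7}
    (hs : IsCoordinates Ω s) {x : Fin 7 → ℂ} (hx : x ∈ Ω) (u v w : Fin 7 → ℂ) :
    metricDeriv s x u v w = metricDeriv s x v u w := by
  rw [metricDeriv, Finset.sum_comm]
  refine Finset.sum_congr rfl fun i _ => Finset.sum_congr rfl fun k _ =>
    Finset.sum_congr rfl fun j _ => ?_
  rw [hs.dz_coeff_comm hx i j k, mul_comm (u k)]

/-- The real derivative splits into its `∂` and `∂̄` parts; Hermitian symmetry rewrites the latter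
as a conjugate with `v` and `w` exchanged. -/
theorem fderiv_kahlerForm {Ω : Set (Fin 7 → ℂ)} {s : (Fin 7 → ℂ) → SO7}
    (hs : IsCoordinates Ω s) {x : Fin 7 → ℂ} (hx : x ∈ Ω) (u v w : Fin 7 → ℂ) :
    fderiv ℝ (fun y => kahlerForm canonicalForm s y v w) x u =
      (Complex.I * (metricDeriv s x u v w + conj (metricDeriv s x u w v))).re := by
  have hd : ∀ i j, DifferentiableAt ℝ (fun y => coeff canonicalForm s y i j) x := fun i j =>
    (hs.coeff_contDiffAt hx i j).differentiableAt (by norm_num)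
  have h1 : HasFDerivAt (fun y => ∑ i, ∑ j, coeff canonicalForm s y i j *
      (Complex.I * v i) * conj (w j))
      (∑ i, ∑ j, (Complex.I * v i * conj (w j)) •
        fderiv ℝ (fun y => coeff canonicalForm s y i j) x) x := by
    refine HasFDerivAt.fun_sum fun i _ => HasFDerivAt.fun_sum fun j _ => ?_
    refine ((hd i j).hasFDerivAt.const_mul (Complex.I * v i * conj (w j))).congr_of_eventuallyEq
      (Eventually.of_forall fun y => ?_)
    simp only
    ring
  have h2 : HasFDerivAt (fun y => kahlerForm canonicalForm s y v w) _ x :=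
    Complex.reCLM.hasFDerivAt.comp x h1
  rw [h2.fderiv, ContinuousLinearMap.comp_apply, Complex.reCLM_apply]
  congr 1
  simp only [sum_apply, smul_apply, smul_eq_mul, fderiv_eq_sum_wirtinger, metricDeriv,
    mul_add, Finset.sum_add_distrib, map_sum, Finset.mul_sum]
  congr 1
  · conv_rhs => rw [Finset.sum_comm]
    refine Finset.sum_congr rfl fun i _ => ?_
    conv_rhs => rw [Finset.sum_comm]
    refine Finset.sum_congr rfl fun j _ => Finset.sum_congr rfl fun k _ => ?_
    ring
  · rw [Finset.sum_comm]
    conv_rhs => rw [Finset.sum_comm]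
    refine Finset.sum_congr rfl fun j _ => ?_
    rw [Finset.sum_comm]
    refine Finset.sum_congr rfl fun k _ => Finset.sum_congr rfl fun i _ => ?_
    rw [hs.dzbar_coeff hx]
    simp only [map_mul, Complex.conj_conj]
    ring

theorem isKahler_canonicalForm : IsKahler canonicalForm := by
  refine ⟨isCanonicalMetric_canonicalForm.toIsHermitianMetric, fun Ω s hs x hx u v w => ?_⟩
  -- Symmetry of `metricDeriv` in its first two arguments leaves three imaginary parts, each
  -- occurring once with either sign.
  rw [fderiv_kahlerForm hs hx, fderiv_kahlerForm hs hx, fderiv_kahlerForm hs hx,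
    metricDeriv_comm hs hx v u w, metricDeriv_comm hs hx w u v, metricDeriv_comm hs hx w v u]
  simp only [Complex.mul_re, Complex.add_re, Complex.add_im, Complex.conj_re, Complex.conj_im,
    Complex.I_re, Complex.I_im]
  ring

theorem isKahlerEinstein_canonicalForm : IsKahlerEinstein canonicalForm 4 :=
  ⟨isKahler_canonicalForm, fun _ _ hs x hx i j => by
    rw [hs.ricci_canonicalForm hx i j]; norm_num⟩

/-! ### Holomorphic coordinates -/

/-- The nilpotent matrix with given coordinates. -/
def nilMat (y : Fin 7 → ℂ) : Mat := ∑ k, y k • basisVec k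

/-- The exponential of a nilpotent matrix of index three. -/
def expMat (X : Mat) : Mat := 1 + X + ((1 / 2 : ℂ) • (1 : Mat)) * (X * X)

/-- `X` raises the degree by at least `d`. -/
def RaisesDegree (d : ℤ) (X : Mat) : Prop := ∀ i j, X i j ≠ 0 → d ≤ wt 1 i - wt 1 j

theorem RaisesDegree.mul {d e : ℤ} {X Y : Mat} (hX : RaisesDegree d X) (hY : RaisesDegree e Y) :
    RaisesDegree (d + e) (X * Y) := by
  intro i j hij
  rw [Matrix.mul_apply] at hij
  obtain ⟨k, -, hk⟩ := Finset.exists_ne_zero_of_sum_ne_zero hij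
  have h1 := hX i k (left_ne_zero_of_mul hk)
  have h2 := hY k j (right_ne_zero_of_mul hk)
  omega

theorem RaisesDegree.eq_zero {d : ℤ} {X : Mat} (hX : RaisesDegree d X) (hd : 3 ≤ d) : X = 0 := by
  have h : ∀ i j : Fin 7, wt 1 i - wt 1 j < 3 := by decide
  ext i j
  by_contra hij
  have := hX i j hij
  have := h i j
  omega

theorem raisesDegree_sum {d : ℤ} {y : Fin 7 → ℂ} (hy : ∀ k, y k ≠ 0 → d ≤ deg k) :
    RaisesDegree d (nilMat y) := by
  intro i j hij
  rw [nilMat, Matrix.sum_apply] at hij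
  obtain ⟨k, -, hk⟩ := Finset.exists_ne_zero_of_sum_ne_zero hij
  rw [Matrix.smul_apply, smul_eq_mul] at hk
  have h1 := (mPlus_grade (basisVec_mem_mPlus k)).2 i j (right_ne_zero_of_mul hk)
  rw [h1]
  exact hy k (left_ne_zero_of_mul hk)

theorem raisesDegree_nilMat (y : Fin 7 → ℂ) : RaisesDegree 1 (nilMat y) :=
  raisesDegree_sum fun k _ => deg_pos k

/-- Each factor raises the degree by at least one, while degrees of matrix positions never exceed
two. -/
theorem nilMat_mul_three (x y z : Fin 7 → ℂ) : nilMat x * nilMat y * nilMat z = 0 :=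
  (((raisesDegree_nilMat x).mul (raisesDegree_nilMat y)).mul (raisesDegree_nilMat z)).eq_zero
    (by norm_num)

theorem nilMat_neg (y : Fin 7 → ℂ) : nilMat (-y) = - nilMat y := by
  simp [nilMat]

theorem expMat_neg_mul (y : Fin 7 → ℂ) : expMat (nilMat (-y)) * expMat (nilMat y) = 1 := by
  have h3 := nilMat_mul_three y y y
  rw [expMat, expMat, nilMat_neg]
  set X := nilMat y
  have h4 : X * (X * X) = 0 := by rw [← mul_assoc, h3]
  simp only [Matrix.smul_mul, one_mul, add_mul, mul_add, mul_one, Matrix.mul_smul,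
    neg_mul, mul_neg, neg_neg, h3, h4, mul_assoc, mul_zero, smul_zero, neg_zero, add_zero]
  module

/-- Moving the Gram matrix past the transpose replaces `X` by `-X`, the defining relation of `so7`.
-/
theorem expMat_gram (y : Fin 7 → ℂ) :
    (expMat (nilMat y)).transpose * gram * expMat (nilMat y) = gram := by
  have h1 : (nilMat y).transpose * gram = gram * nilMat (-y) := by
    have := mem_so7_iff.1 (sum_basisVec_mem y)
    have := congrArg (gram * ·) this
    simp only [← mul_assoc, gram_mul_gram, one_mul] at this
    rw [nilMat_neg]
    exact this
  have h2 : (expMat (nilMat y)).transpose * gram = gram * expMat (nilMat (-y)) := by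
    rw [expMat, expMat]
    simp only [Matrix.transpose_add, Matrix.transpose_one, Matrix.transpose_mul,
      Matrix.transpose_smul, Matrix.smul_mul, one_mul, Matrix.mul_smul, mul_one, add_mul, mul_add,
      mul_assoc, h1]
    rw [← mul_assoc _ gram, h1, mul_assoc]
  rw [h2, mul_assoc, expMat_neg_mul, mul_one]

/-- Positions of positive degree lie above the diagonal, so the matrix is unitriangular. -/
theorem expMat_det (y : Fin 7 → ℂ) : (expMat (nilMat y)).det = 1 := by
  have hX := raisesDegree_nilMat y
  have hXX := hX.mul hX
  have hlt : ∀ i j : Fin 7, 1 ≤ wt 1 i - wt 1 j → i < j := by decide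
  have hentry : ∀ i j, ¬ i < j → expMat (nilMat y) i j = (1 : Mat) i j := by
    intro i j hij
    have h1 : nilMat y i j = 0 := by
      by_contra h
      exact hij (hlt i j (hX i j h))
    have h2 : (nilMat y * nilMat y) i j = 0 := by
      by_contra h
      exact hij (hlt i j (by have := hXX i j h; omega))
    simp [expMat, h1, h2]
  rw [Matrix.det_of_isUpperTriangular]
  · refine Finset.prod_eq_one fun i _ => ?_
    rw [hentry i i (lt_irrefl i), Matrix.one_apply_eq]
  · intro i j hij
    have hij : j < i := hij
    rw [hentry i j (not_lt.2 hij.le)]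
    exact Matrix.one_apply_ne hij.ne'

/-- The unipotent elements of the group that give the coordinates. -/
def expSO7 (y : Fin 7 → ℂ) : SO7 :=
  ⟨⟨expMat (nilMat y), expMat (nilMat (-y)), mul_eq_one_comm.1 (expMat_neg_mul y),
    expMat_neg_mul y⟩, expMat_gram y, expMat_det y⟩

theorem toMat_expSO7_inv (y : Fin 7 → ℂ) : toMat (expSO7 y)⁻¹ = expMat (nilMat (-y)) := rfl

theorem analyticAt_mul {M N : (Fin 7 → ℂ) → Mat} {x : Fin 7 → ℂ}
    (hM : ∀ a b, AnalyticAt ℂ (fun y => M y a b) x)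
    (hN : ∀ a b, AnalyticAt ℂ (fun y => N y a b) x) (a b : Fin 7) :
    AnalyticAt ℂ (fun y => (M y * N y) a b) x := by
  simp only [Matrix.mul_apply]
  exact Finset.analyticAt_fun_sum _ fun k _ => (hM a k).mul (hN k b)

theorem analyticAt_const_mul (A : Mat) {N : (Fin 7 → ℂ) → Mat} {x : Fin 7 → ℂ}
    (hN : ∀ a b, AnalyticAt ℂ (fun y => N y a b) x) (a b : Fin 7) :
    AnalyticAt ℂ (fun y => (A * N y) a b) x :=
  analyticAt_mul (M := fun _ => A) (fun _ _ => analyticAt_const) hN a b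

theorem analyticAt_nilMat (x : Fin 7 → ℂ) (a b : Fin 7) :
    AnalyticAt ℂ (fun y => nilMat y a b) x := by
  simp only [nilMat, Matrix.sum_apply, Matrix.smul_apply, smul_eq_mul]
  exact Finset.analyticAt_fun_sum _ fun k _ =>
    ((ContinuousLinearMap.proj (R := ℂ) (φ := fun _ : Fin 7 => ℂ) k).analyticAt x).mul
      analyticAt_const

theorem analyticAt_expMat (x : Fin 7 → ℂ) (a b : Fin 7) :
    AnalyticAt ℂ (fun y => expMat (nilMat y) a b) x := by
  simp only [expMat, Matrix.add_apply]
  have h1 : AnalyticAt ℂ (fun _ : Fin 7 → ℂ => (1 : Mat) a b) x := analyticAt_const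
  exact (h1.add (analyticAt_nilMat x a b)).add (analyticAt_const_mul _
    (analyticAt_mul (analyticAt_nilMat x) (analyticAt_nilMat x)) a b)

theorem smoothAt_nilMat (x : Fin 7 → ℂ) : SmoothAt ℂ nilMat x := fun a b =>
  (analyticAt_nilMat x a b).contDiffAt

theorem wdM_nilMat (i : Fin 7) (x : Fin 7 → ℂ) :
    wdM (-Complex.I) i nilMat x = basisVec i := by
  ext a b
  rw [wdM, Matrix.of_apply, ← dz_eq_wd,
    dz_of_holomorphic ((smoothAt_nilMat x).differentiableAt a b)]
  have h : HasFDerivAt (fun y : Fin 7 → ℂ => nilMat y a b)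
      (∑ k, (basisVec k a b) • ContinuousLinearMap.proj (R := ℂ) (φ := fun _ : Fin 7 => ℂ) k)
      x := by
    simp only [nilMat, Matrix.sum_apply, Matrix.smul_apply, smul_eq_mul]
    exact HasFDerivAt.fun_sum fun k _ => (ContinuousLinearMap.proj (R := ℂ)
      (φ := fun _ : Fin 7 => ℂ) k).hasFDerivAt.mul_const (basisVec k a b)
  rw [h.fderiv]
  simp [sum_apply, Pi.single_apply]

theorem wdM_add {c : ℂ} {i : Fin 7} {x : Fin 7 → ℂ} {M N : (Fin 7 → ℂ) → Mat}
    (hM : SmoothAt ℝ M x) (hN : SmoothAt ℝ N x) :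
    wdM c i (fun y => M y + N y) x = wdM c i M x + wdM c i N x := by
  ext a b
  exact wd_add (hM.differentiableAt a b) (hN.differentiableAt a b)

theorem wdM_expMat (i : Fin 7) (x : Fin 7 → ℂ) :
    wdM (-Complex.I) i (fun y => expMat (nilMat y)) x =
      basisVec i + (1 / 2 : ℂ) • (basisVec i * nilMat x + nilMat x * basisVec i) := by
  have h := (smoothAt_nilMat x).restrictScalars
  have h2 : SmoothAt ℝ (fun y => nilMat y * nilMat y) x := h.mul h
  have hc : ∀ A : Mat, SmoothAt ℝ (fun _ : Fin 7 → ℂ => A) x := fun A => SmoothAt.const A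
  have h1 : SmoothAt ℝ (fun y => 1 + nilMat y) x := fun a b => contDiffAt_const.add (h a b)
  simp only [expMat]
  rw [wdM_add h1 ((hc _).mul h2), wdM_add (hc 1) h, wdM_mul (hc _) h2, wdM_mul h h, wdM_const,
    wdM_const, wdM_nilMat, zero_add, Matrix.zero_mul, zero_add, Matrix.smul_mul, Matrix.one_mul]

/-- The coordinates around a point given by the exponential map. -/
def chart (g : SO7) (y : Fin 7 → ℂ) : SO7 := g * expSO7 y

theorem smoothAt_chart (g : SO7) (x : Fin 7 → ℂ) : SmoothAt ℂ (fun y => toMat (chart g y)) x :=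
  fun a b => (analyticAt_const_mul (toMat g) (analyticAt_expMat x) a b).contDiffAt

theorem basisVec_eq_nilMat (i : Fin 7) : basisVec i = nilMat (Pi.single i 1) := by
  simp [nilMat, Pi.single_apply]

/-- The logarithmic derivative of the exponential stops after the first commutator because triple
products vanish. -/
theorem coordVec_chart (g : SO7) (x : Fin 7 → ℂ) (i : Fin 7) :
    coordVec (chart g) x i =
      basisVec i + (1 / 2 : ℂ) • (basisVec i * nilMat x - nilMat x * basisVec i) := by
  have h1 : (Matrix.of fun a b => fderiv ℂ (fun y => toMat (chart g y) a b) x (Pi.single i 1)) =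
      wdM (-Complex.I) i (fun y => toMat (chart g y)) x := by
    ext a b
    rw [wdM, Matrix.of_apply, Matrix.of_apply, ← dz_eq_wd,
      dz_of_holomorphic ((smoothAt_chart g x).differentiableAt a b)]
  have hg : SmoothAt ℝ (fun _ : Fin 7 → ℂ => toMat g) x := SmoothAt.const _
  have he : SmoothAt ℝ (fun y => expMat (nilMat y)) x := fun a b =>
    (analyticAt_expMat x a b).contDiffAt.restrict_scalars ℝ
  have h2 := wdM_mul (c := -Complex.I) (i := i) hg he
  rw [wdM_const, Matrix.zero_mul, zero_add, wdM_expMat] at h2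
  have h3 : toMat (chart g x)⁻¹ = expMat (nilMat (-x)) * toMat g⁻¹ := by
    rw [chart, mul_inv_rev, toMat_mul, toMat_expSO7_inv]
  rw [coordVec, h1, h3]
  change _ * wdM (-Complex.I) i (fun y => toMat g * expMat (nilMat y)) x = _
  rw [h2, mul_assoc, ← mul_assoc (toMat g⁻¹), toMat_inv_mul, one_mul, expMat, nilMat_neg]
  have t1 := nilMat_mul_three x x (Pi.single i 1)
  have t2 := nilMat_mul_three x (Pi.single i 1) x
  rw [← basisVec_eq_nilMat] at t1 t2
  set X := nilMat x
  set B := basisVec i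
  rw [mul_assoc] at t1 t2
  simp only [Matrix.smul_mul, one_mul, add_mul, mul_add, Matrix.mul_smul,
    neg_mul, mul_neg, neg_neg, mul_assoc, t1, t2, mul_zero, smul_zero, neg_zero, add_zero, smul_add]
  module

theorem isCoordinates_chart (g : SO7) : IsCoordinates Set.univ (chart g) where
  isOpen := isOpen_univ
  holomorphic a b x _ :=
    analyticAt_const_mul (toMat g) (analyticAt_expMat x) a b
  immersion x _ c hc := by
    have h1 : ∑ i, c i • coordVec (chart g) x i =
        nilMat c + (1 / 2 : ℂ) • (nilMat c * nilMat x - nilMat x * nilMat c) := by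
      simp only [coordVec_chart, smul_add, Finset.sum_add_distrib]
      congr 1
      simp only [nilMat, Finset.sum_mul, Finset.mul_sum, smul_sub, Finset.smul_sum,
        Finset.sum_sub_distrib, Matrix.smul_mul, Matrix.mul_smul]
      congr 1
      · rw [Finset.sum_comm]
        refine Finset.sum_congr rfl fun k _ => Finset.sum_congr rfl fun l _ => ?_
        module
      · refine Finset.sum_congr rfl fun k _ => Finset.sum_congr rfl fun l _ => ?_
        module
    rw [h1] at hc
    have hcoord : ∀ a, coord (nilMat c) a = c a := fun a => by
      simp [nilMat, coord_sum, coord_smul, coord_basisVec]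
    have hdeg : ∀ a, deg a = wt 1 (row a) - wt 1 (col a) := by decide
    have hcase : ∀ a, deg a = 1 ∨ deg a = 2 := by decide
    -- The commutator with `nilMat x` has degree at least `d + 1`, so it does not affect lower
    -- coordinates. Using this for `d = 1` and then `d = 2` kills the components degree by degree.
    have hzero : ∀ d : ℤ, RaisesDegree d (nilMat c) → ∀ a, deg a < d + 1 → c a = 0 := by
      intro d hd a ha
      have h2 := coord_eq_zero hc a
      have h3 : coord (nilMat c * nilMat x - nilMat x * nilMat c) a = 0 := by
        rw [coord_sub]
        have h4 : coord (nilMat c * nilMat x) a = 0 := by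
          by_contra h
          have := hd.mul (raisesDegree_nilMat x) _ _ h
          rw [← hdeg] at this
          omega
        have h5 : coord (nilMat x * nilMat c) a = 0 := by
          by_contra h
          have := (raisesDegree_nilMat x).mul hd _ _ h
          rw [← hdeg] at this
          omega
        rw [h4, h5, sub_zero]
      rwa [coord_add, coord_smul, h3, mul_zero, add_zero, hcoord] at h2
    have hfirst : ∀ a, deg a = 1 → c a = 0 := fun a ha =>
      hzero 1 (raisesDegree_nilMat c) a (by omega)
    have h2 : RaisesDegree 2 (nilMat c) := raisesDegree_sum fun k hk =>
      (hcase k).elim (fun h => absurd (hfirst k h) hk) fun h => h.ge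
    ext a
    exact hzero 2 h2 a (by rcases hcase a with h | h <;> omega)

theorem exists_coordinates (m : M) :
    ∃ Ω s, IsCoordinates Ω s ∧ ∃ x ∈ Ω, (s x : M) = m := by
  obtain ⟨g, rfl⟩ := QuotientGroup.mk_surjective m
  refine ⟨Set.univ, chart g, isCoordinates_chart g, 0, Set.mem_univ _, ?_⟩
  have h : expSO7 0 = 1 := by
    refine Subtype.ext (Units.ext ?_)
    change expMat (nilMat 0) = 1
    simp [expMat, nilMat]
  rw [chart, h, mul_one]

end BThree

end

theorem mainTheorem3 :
    (∀ m : BThree.M, ∃ Ω s, BThree.IsCoordinates Ω s ∧ ∃ x ∈ Ω, (s x : BThree.M) = m) ∧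
    ∃ h : BThree.Form, BThree.IsCanonicalMetric h ∧
      (∀ h₂ : BThree.Form, BThree.IsCanonicalMetric h₂ →
        ∀ g, ∀ X ∈ BThree.so7, ∀ Y ∈ BThree.so7, h₂ g X Y = h g X Y) ∧
      BThree.IsKahlerEinstein h 4 :=
  ⟨BThree.exists_coordinates, BThree.canonicalForm, BThree.isCanonicalMetric_canonicalForm,
    fun _ hh g _ hX _ hY => hh.eq_canonicalForm g hX hY, BThree.isKahlerEinstein_canonicalForm⟩
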